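/- Let $C$ be a smooth projective (irreducible) curve over $\mathbb{C}$ of genus $g=\dim_{\mathbb C} H^1(C,\mathcal{O}_C)\geq 1$, and let $L$ be a line bundle on $C$ of degree $d=2g-1$. 1. Let $b\in H^1(C,L^{-1})$ and let $$0\longrightarrow \mathcal{O}_C\longrightarrow E_b\longrightarrow L\longrightarrow 0$$ be an extension of $L$ by $\mathcal{O}_C$ with extension class $b$. Then $\dim_{\mathbb C} H^0(C,E_b)=1$ if and only if the cup-product map $$\langle\,\cdot\,,b\rangle\colon H^0(C,L)\longrightarrow H^1(C,\mathcal{O}_C)$$ is an isomorphism. 2. Moreover, $\dim_{\mathbb C} H^0(C,E_b)=1$ for a generic $b$: the space $H^1(C,L^{-1})$ is finite-dimensional and contains a nonempty Zariski-open subset $U$ such that $\dim_{\mathbb C} H^0(C,E_b)=1$ for every $b\in U$ and every extension $E_b$ with class $b$. -/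

import Mathlib

open CategoryTheory AlgebraicGeometry TopologicalSpace

noncomputable section

namespace CurveExt

universe u

/-! ## Čech cohomology in degree one -/

section Cech

variable {X : TopCat.{0}}

/-- An open covering of `X` indexed by the points of `X`: an open neighbourhood of each point.
Every open covering is refined by one of these. -/
structure PointedCover (X : TopCat.{0}) where
  nhd : X → Opens X
  mem : ∀ x, x ∈ nhd x

/-- `𝒰 ≤ 𝒱` when `𝒱` refines `𝒰`. -/
instance : Preorder (PointedCover X) where
  le 𝒰 𝒱 := ∀ x, 𝒱.nhd x ≤ 𝒰.nhd x
  le_refl _ _ := le_rfl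
  le_trans _ _ _ h h' x := (h' x).trans (h x)

instance : Nonempty (PointedCover X) := ⟨⟨fun _ => ⊤, fun _ => trivial⟩⟩

instance : IsDirectedOrder (PointedCover X) where
  directed 𝒰 𝒱 := ⟨⟨fun x => 𝒰.nhd x ⊓ 𝒱.nhd x, fun x => ⟨𝒰.mem x, 𝒱.mem x⟩⟩,
    fun _ => inf_le_left, fun _ => inf_le_right⟩

/-- A presheaf of complex vector spaces. -/
abbrev CPresheaf (X : TopCat.{0}) := TopCat.Presheaf (ModuleCat.{0} ℂ) X

/-- Restriction of sections of a presheaf of complex vector spaces. -/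
def res (F : CPresheaf X) {U V : Opens X} (h : V ≤ U) : F.obj (.op U) →ₗ[ℂ] F.obj (.op V) :=
  (F.map (homOfLE h).op).hom

@[simp] lemma res_self (F : CPresheaf X) {U : Opens X} (h : U ≤ U) (s : F.obj (.op U)) :
    res F h s = s := by
  simp [res]

@[simp] lemma res_res (F : CPresheaf X) {U V W : Opens X} (h : V ≤ U) (h' : W ≤ V)
    (s : F.obj (.op U)) : res F h' (res F h s) = res F (h'.trans h) s := by
  have : (homOfLE (h'.trans h)).op = (homOfLE h).op ≫ (homOfLE h').op := rfl
  simp [res, this]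

lemma res_naturality {F G : CPresheaf X} (η : F ⟶ G) {U V : Opens X} (h : V ≤ U)
    (s : F.obj (.op U)) : (η.app (.op V)).hom (res F h s) = res G h ((η.app (.op U)).hom s) :=
  congr($(η.naturality (homOfLE h).op).hom s)

/-- Čech cocycles of degree one: families `c x y ∈ F (U_x ∩ U_y)` with
`c x z = c x y + c y z` on `U_x ∩ U_y ∩ U_z`. -/
def cocycles (F : CPresheaf X) (𝒰 : PointedCover X) :
    Submodule ℂ (∀ x y, F.obj (.op (𝒰.nhd x ⊓ 𝒰.nhd y))) where
  carrier := {c | ∀ x y z (V : Opens X) (hx : V ≤ 𝒰.nhd x) (hy : V ≤ 𝒰.nhd y) (hz : V ≤ 𝒰.nhd z),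
    res F (le_inf hx hz) (c x z) = res F (le_inf hx hy) (c x y) + res F (le_inf hy hz) (c y z)}
  add_mem' {c d} hc hd x y z V hx hy hz := by
    simp only [Pi.add_apply, map_add, hc x y z V hx hy hz, hd x y z V hx hy hz]
    abel
  zero_mem' x y z V hx hy hz := by simp
  smul_mem' a c hc x y z V hx hy hz := by
    simp only [Pi.smul_apply, map_smul, hc x y z V hx hy hz, smul_add]

/-- The Čech differential `(s_x) ↦ (s_y - s_x)` on `0`-cochains. -/
def coboundary (F : CPresheaf X) (𝒰 : PointedCover X) :
    (∀ x, F.obj (.op (𝒰.nhd x))) →ₗ[ℂ] cocycles F 𝒰 where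
  toFun s := ⟨fun x y => res F inf_le_right (s y) - res F inf_le_left (s x), by
    intro x y z V hx hy hz
    simp⟩
  map_add' s t := by
    ext x y
    simp only [Pi.add_apply, map_add, Submodule.coe_add]
    abel
  map_smul' a s := by
    ext x y
    simp [smul_sub]

/-- Restriction of cocycles to a refinement. -/
def cocyclesRes (F : CPresheaf X) {𝒰 𝒱 : PointedCover X} (h : 𝒰 ≤ 𝒱) :
    cocycles F 𝒰 →ₗ[ℂ] cocycles F 𝒱 where
  toFun c := ⟨fun x y => res F (inf_le_inf (h x) (h y)) (c.1 x y), by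
    intro x y z V hx hy hz
    simpa using c.2 x y z V (hx.trans (h x)) (hy.trans (h y)) (hz.trans (h z))⟩
  map_add' c d := by ext x y; simp
  map_smul' a c := by ext x y; simp

/-- The first Čech cohomology group of a covering. -/
def CechH1 (F : CPresheaf X) (𝒰 : PointedCover X) : Type :=
  cocycles F 𝒰 ⧸ LinearMap.range (coboundary F 𝒰)

instance (F : CPresheaf X) (𝒰 : PointedCover X) : AddCommGroup (CechH1 F 𝒰) :=
  Submodule.Quotient.addCommGroup (LinearMap.range (coboundary F 𝒰))

instance (F : CPresheaf X) (𝒰 : PointedCover X) : Module ℂ (CechH1 F 𝒰) :=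
  Submodule.Quotient.module (LinearMap.range (coboundary F 𝒰))

/-- The class of a cocycle in the first Čech cohomology group of the covering. -/
def CechH1.mk (F : CPresheaf X) (𝒰 : PointedCover X) : cocycles F 𝒰 →ₗ[ℂ] CechH1 F 𝒰 :=
  Submodule.mkQ (LinearMap.range (coboundary F 𝒰))

lemma CechH1.mk_surjective (F : CPresheaf X) (𝒰 : PointedCover X) :
    Function.Surjective (CechH1.mk F 𝒰) :=
  Submodule.mkQ_surjective _

/-- The refinement map on first Čech cohomology groups. -/
def CechH1.res (F : CPresheaf X) (𝒰 𝒱 : PointedCover X) (h : 𝒰 ≤ 𝒱) :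
    CechH1 F 𝒰 →ₗ[ℂ] CechH1 F 𝒱 :=
  Submodule.mapQ _ _ (cocyclesRes F h) <| by
    rintro _ ⟨s, rfl⟩
    refine ⟨fun x => CurveExt.res F (h x) (s x), ?_⟩
    ext x y
    simp [coboundary, cocyclesRes]

open Classical in
/-- The first cohomology group `H¹(X, F)`: the colimit over all open coverings of the first Čech
cohomology groups. -/
def H1 (F : CPresheaf X) : Type :=
  Module.DirectLimit (CechH1 F) (CechH1.res F)

open Classical in
instance (F : CPresheaf X) : AddCommGroup (H1 F) :=
  Module.DirectLimit.addCommGroup (CechH1 F) (CechH1.res F)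

open Classical in
instance (F : CPresheaf X) : Module ℂ (H1 F) :=
  Module.DirectLimit.module (CechH1 F) (CechH1.res F)

open Classical in
/-- The cohomology class of a cocycle. -/
def H1.mk (F : CPresheaf X) (𝒰 : PointedCover X) : cocycles F 𝒰 →ₗ[ℂ] H1 F :=
  Module.DirectLimit.of ℂ (PointedCover X) (CechH1 F) (CechH1.res F) 𝒰 ∘ₗ CechH1.mk F 𝒰

lemma H1.exists_mk {F : CPresheaf X} (b : H1 F) : ∃ 𝒰 c, H1.mk F 𝒰 c = b := by
  classical
  obtain ⟨𝒰, q, rfl⟩ := Module.DirectLimit.exists_of b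
  obtain ⟨c, rfl⟩ := CechH1.mk_surjective F 𝒰 q
  exact ⟨𝒰, c, rfl⟩

/-- The map induced on cocycles by a morphism of presheaves. -/
def cocyclesMap {F G : CPresheaf X} (η : F ⟶ G) (𝒰 : PointedCover X) :
    cocycles F 𝒰 →ₗ[ℂ] cocycles G 𝒰 where
  toFun c := ⟨fun x y => (η.app _).hom (c.1 x y), by
    intro x y z V hx hy hz
    simp only [← res_naturality, c.2 x y z V hx hy hz, map_add]⟩
  map_add' c d := by ext x y; simp
  map_smul' a c := by ext x y; simp

/-- The map induced on Čech cohomology of a covering by a morphism of presheaves. -/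
def CechH1.map {F G : CPresheaf X} (η : F ⟶ G) (𝒰 : PointedCover X) :
    CechH1 F 𝒰 →ₗ[ℂ] CechH1 G 𝒰 :=
  Submodule.mapQ _ _ (cocyclesMap η 𝒰) <| by
    rintro _ ⟨s, rfl⟩
    refine ⟨fun x => (η.app _).hom (s x), ?_⟩
    ext x y
    simp [coboundary, cocyclesMap, res_naturality]

open Classical in
/-- The map `H¹(X, F) → H¹(X, G)` induced by a morphism of presheaves. -/
def H1.map {F G : CPresheaf X} (η : F ⟶ G) : H1 F →ₗ[ℂ] H1 G :=
  Module.DirectLimit.map (fun 𝒰 => CechH1.map η 𝒰) <| by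
    intro 𝒰 𝒱 h
    refine LinearMap.ext fun q => ?_
    obtain ⟨c, rfl⟩ := CechH1.mk_surjective F 𝒰 q
    change CechH1.mk G 𝒱 (cocyclesMap η 𝒱 (cocyclesRes F h c)) =
      CechH1.mk G 𝒱 (cocyclesRes G h (cocyclesMap η 𝒰 c))
    congr 1
    ext x y
    simp [cocyclesMap, cocyclesRes, res_naturality]

lemma H1.map_mk {F G : CPresheaf X} (η : F ⟶ G) (𝒰 : PointedCover X) (c : cocycles F 𝒰) :
    H1.map η (H1.mk F 𝒰 c) = H1.mk G 𝒰 (cocyclesMap η 𝒰 c) := by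
  classical
  exact Module.DirectLimit.map_apply_of (CechH1.map η) _ _

end Cech

/-! ## Smooth projective curves and sheaves of modules on them -/

/-- The complex numbers as an affine scheme. -/
abbrev SpecC : Scheme.{0} := Spec (CommRingCat.of ℂ)

/-- A smooth projective (irreducible) curve over `ℂ`. (A proper curve over a field is
projective.) -/
class IsSmoothProjectiveCurve (C : Scheme.{0}) [C.Over SpecC] : Prop where
  isIntegral : IsIntegral C
  isProper : IsProper (C ↘ SpecC)
  smooth : SmoothOfRelativeDimension 1 (C ↘ SpecC)

instance (C : Scheme.{0}) [C.Over SpecC] [h : IsSmoothProjectiveCurve C] : IsIntegral C :=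
  h.isIntegral

instance (C : Scheme.{0}) [C.Over SpecC] [h : IsSmoothProjectiveCurve C] :
    IsLocallyNoetherian C :=
  have := h.isProper
  LocallyOfFiniteType.isLocallyNoetherian (C ↘ SpecC)

section Modules

variable {C : Scheme.{0}}

/-- The structure sheaf as a sheaf of modules over itself. -/
abbrev structureSheaf (C : Scheme.{0}) : C.Modules := SheafOfModules.unit C.ringCatSheaf

/-- Restriction of sections of a sheaf of modules. -/
def mres (M : C.Modules) {U V : C.Opens} (h : V ≤ U) : Γ(M, U) →+ Γ(M, V) :=
  (M.presheaf.map (homOfLE h).op).hom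

/-- Restriction of functions. -/
def fres {U V : C.Opens} (h : V ≤ U) : Γ(C, U) →+* Γ(C, V) :=
  (C.presheaf.map (homOfLE h).op).hom

@[simp] lemma mres_smul (M : C.Modules) {U V : C.Opens} (h : V ≤ U) (f : Γ(C, U)) (s : Γ(M, U)) :
    mres M h (f • s) = fres h f • mres M h s :=
  M.map_smul (homOfLE h) f s

@[simp] lemma mres_self (M : C.Modules) {U : C.Opens} (h : U ≤ U) (s : Γ(M, U)) :
    mres M h s = s := by
  simp [mres]

@[simp] lemma mres_mres (M : C.Modules) {U V W : C.Opens} (h : V ≤ U) (h' : W ≤ V)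
    (s : Γ(M, U)) : mres M h' (mres M h s) = mres M (h'.trans h) s := by
  have : (homOfLE (h'.trans h)).op = (homOfLE h).op ≫ (homOfLE h').op := rfl
  simp [mres, this]

/-- `e` is a frame of `M` over `U`: multiplication by `e` is an isomorphism `𝒪|_U → M|_U`. -/
def IsFrame (M : C.Modules) (U : C.Opens) (e : Γ(M, U)) : Prop :=
  ∀ (V : C.Opens) (h : V ≤ U), Function.Bijective fun f : Γ(C, V) => f • mres M h e

/-- A line bundle: a sheaf of modules locally isomorphic to the structure sheaf. -/
def IsLineBundle (M : C.Modules) : Prop :=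
  ∀ x : C, ∃ (U : C.Opens) (e : Γ(M, U)), x ∈ U ∧ IsFrame M U e

/-- The rational section of `M` given by `s ∈ Γ(V, M)` has order `n` at `x`: on some nonempty open
`W` one has `s = f • e` for a frame `e` of `M` around `x`, and `f`, viewed in the function field,
vanishes to order `n` at `x`. (At the generic point the order of vanishing is `0` by convention.) -/
def HasOrderAt [IsIntegral C] [IsLocallyNoetherian C] (M : C.Modules) {V : C.Opens} (s : Γ(M, V))
    (x : C) (n : ℤ) : Prop :=
  ∃ (U : C.Opens) (e : Γ(M, U)) (W : C.Opens) (hU : W ≤ U) (hV : W ≤ V) (_ : Nonempty W)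
    (f : Γ(C, W)), x ∈ U ∧ IsFrame M U e ∧ mres M hV s = f • mres M hU e ∧
      Scheme.ord (C.germToFunctionField W f) x = n

/-- The line bundle `M` has degree `d`: some nonzero rational section of `M` has a divisor of
degree `d`. -/
def HasDegree [IsIntegral C] [IsLocallyNoetherian C] (M : C.Modules) (d : ℤ) : Prop :=
  ∃ (V : C.Opens) (s : Γ(M, V)) (D : C →₀ ℤ), s ≠ 0 ∧ (∀ x, HasOrderAt M s x (D x)) ∧
    D.sum (fun _ n => n) = d

/-- An extension `0 → 𝒪 → E → M → 0`. -/
structure Extension (M : C.Modules) where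
  E : C.Modules
  i : structureSheaf C ⟶ E
  p : E ⟶ M
  zero : i ≫ p = 0
  shortExact : (ShortComplex.mk i p zero).ShortExact

variable [C.Over SpecC]

/-- The complex numbers as functions on an open subset. -/
def constants (U : C.Opens) : ℂ →+* Γ(C, U) :=
  (fres le_top).comp ((C ↘ SpecC).appTop.hom.comp (Scheme.ΓSpecIso (.of ℂ)).inv.hom)

instance (U : C.Opens) : Algebra ℂ Γ(C, U) := (constants U).toAlgebra

/-- Sections of a sheaf of modules form a complex vector space. -/
instance (M : C.Modules) (U : C.Opens) : Module ℂ Γ(M, U) := Module.compHom _ (constants U)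

instance (M : C.Modules) (U : C.Opens) : IsScalarTower ℂ Γ(C, U) Γ(M, U) where
  smul_assoc a f s := mul_smul (constants U a) f s

lemma constants_smul (M : C.Modules) (U : C.Opens) (a : ℂ) (s : Γ(M, U)) :
    a • s = constants U a • s := rfl

@[simp] lemma fres_constants {U V : C.Opens} (h : V ≤ U) (a : ℂ) :
    fres h (constants U a) = constants V a := by
  have : (homOfLE (le_top : V ≤ ⊤)).op = (homOfLE (le_top : U ≤ ⊤)).op ≫ (homOfLE h).op := rfl
  simp [fres, constants, this]

/-- Restriction of sections as a `ℂ`-linear map. -/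
def mresL (M : C.Modules) {U V : C.Opens} (h : V ≤ U) : Γ(M, U) →ₗ[ℂ] Γ(M, V) where
  __ := mres M h
  map_smul' a s := by
    simp [constants_smul]

/-- The presheaf of complex vector spaces underlying a sheaf of modules. -/
def toC (M : C.Modules) : CPresheaf C.toTopCat where
  obj U := ModuleCat.of ℂ Γ(M, U.unop)
  map i := ModuleCat.ofHom (mresL M (leOfHom i.unop))
  map_id U := by ext s; exact mres_self M _ s
  map_comp i j := by ext s; exact (mres_mres M _ _ s).symm

/-- Sections over `U` of the sheaf `ℋom(M, N)`: morphisms `M|_U → N|_U` of sheaves of modules,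
given by their values on the open subsets of `U`. -/
def LocalHom (M N : C.Modules) (U : C.Opens) :
    Submodule ℂ (∀ V : {V : C.Opens // V ≤ U}, Γ(M, V.1) →ₗ[Γ(C, V.1)] Γ(N, V.1)) where
  carrier := {φ | ∀ (V W : {V : C.Opens // V ≤ U}) (h : W.1 ≤ V.1) (s : Γ(M, V.1)),
    φ W (mres M h s) = mres N h (φ V s)}
  add_mem' hφ hψ V W h s := by simp [hφ V W h s, hψ V W h s]
  zero_mem' V W h s := by simp
  smul_mem' a φ hφ V W h s := by
    simp only [Pi.smul_apply, LinearMap.smul_apply, hφ V W h s]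
    exact ((mresL N h).map_smul a _).symm

/-- Restriction of a morphism `M|_U → N|_U` to an open subset `V` of `U`. -/
def LocalHom.res (M N : C.Modules) {U V : C.Opens} (h : V ≤ U) :
    LocalHom M N U →ₗ[ℂ] LocalHom M N V where
  toFun φ := ⟨fun W => φ.1 ⟨W.1, W.2.trans h⟩,
    fun W W' hW s => φ.2 ⟨W.1, W.2.trans h⟩ ⟨W'.1, W'.2.trans h⟩ hW s⟩
  map_add' _ _ := rfl
  map_smul' _ _ := rfl

/-- The sheaf `ℋom(M, N)`. -/
def sheafHom (M N : C.Modules) : CPresheaf C.toTopCat where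
  obj U := ModuleCat.of ℂ (LocalHom M N U.unop)
  map i := ModuleCat.ofHom (LocalHom.res M N (leOfHom i.unop))
  map_id _ := rfl
  map_comp _ _ := rfl

/-- The dual `M⁻¹ = ℋom(M, 𝒪)`. -/
abbrev dual (M : C.Modules) : CPresheaf C.toTopCat := sheafHom M (structureSheaf C)

/-- The first cohomology group of a sheaf of modules. -/
abbrev cohH1 (M : C.Modules) : Type := H1 (toC M)

variable (C) in
/-- The genus `dim H¹(C, 𝒪)` of a curve. -/
def genus : ℕ := Module.finrank ℂ (cohH1 (structureSheaf C))

/-- Evaluation of a morphism `M → N` at a global section of `M`, as a morphism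
`ℋom(M, N) → N`. -/
def evalAt (M N : C.Modules) (s : Γ(M, ⊤)) : sheafHom M N ⟶ toC N where
  app U := ModuleCat.ofHom
    { toFun := fun φ : LocalHom M N U.unop => φ.1 ⟨U.unop, le_rfl⟩ (mres M le_top s)
      map_add' := fun _ _ => rfl
      map_smul' := fun _ _ => rfl }
  naturality U V i := by
    ext φ
    have := (show LocalHom M N U.unop from φ).2 ⟨U.unop, le_rfl⟩ ⟨V.unop, leOfHom i.unop⟩
      (leOfHom i.unop) (mres M le_top s)
    rw [mres_mres] at this
    exact this

/-- The cup product `⟨·, b⟩ : H⁰(C, M) → H¹(C, 𝒪)` with a class `b ∈ H¹(C, M⁻¹)`: a section `s`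
goes to the image of `b` under the map induced by `M⁻¹ → 𝒪`, `φ ↦ φ(s)`. -/
def cup (M : C.Modules) (b : H1 (dual M)) : Γ(M, ⊤) →ₗ[ℂ] cohH1 (structureSheaf C) where
  toFun s := H1.map (evalAt M (structureSheaf C) s) b
  map_add' s t := by
    obtain ⟨𝒰, c, rfl⟩ := H1.exists_mk b
    simp only [H1.map_mk, ← map_add]
    congr 1
    ext x y
    change (show LocalHom M _ _ from c.1 x y).1 ⟨_, le_rfl⟩ (mres M le_top (s + t)) = _
    rw [map_add, map_add]
    rfl
  map_smul' a s := by
    obtain ⟨𝒰, c, rfl⟩ := H1.exists_mk b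
    simp only [H1.map_mk, ← map_smul]
    congr 1
    ext x y
    change (show LocalHom M _ _ from c.1 x y).1 ⟨_, le_rfl⟩ (mresL M le_top (a • s)) = _
    rw [map_smul, constants_smul, map_smul]
    rfl

/-- The extension `0 → 𝒪 → E → M → 0` has class `b ∈ H¹(C, M⁻¹)`: there are splittings
`σ_x : M|_{U_x} → E|_{U_x}` over an open covering, and `b` is the class of the cocycle
`σ_y - σ_x : M → 𝒪` on `U_x ∩ U_y`; that is, `b` is the image of `id_M` under the connecting
homomorphism of `0 → ℋom(M, 𝒪) → ℋom(M, E) → ℋom(M, M) → 0`. -/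
def Extension.HasClass {M : C.Modules} (X : Extension M) (b : H1 (dual M)) : Prop :=
  ∃ (𝒰 : PointedCover C.toTopCat) (σ : ∀ x, LocalHom M X.E (𝒰.nhd x))
    (c : cocycles (dual M) 𝒰),
    (∀ (x : C) (V : C.Opens) (h : V ≤ 𝒰.nhd x) (s : Γ(M, V)),
      X.p.app V ((σ x).1 ⟨V, h⟩ s) = s) ∧
    (∀ (x y : C) (V : C.Opens) (hx : V ≤ 𝒰.nhd x) (hy : V ≤ 𝒰.nhd y) (s : Γ(M, V)),
      X.i.app V ((show LocalHom M (structureSheaf C) (𝒰.nhd x ⊓ 𝒰.nhd y) from c.1 x y).1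
        ⟨V, le_inf hx hy⟩ s) = (σ y).1 ⟨V, hy⟩ s - (σ x).1 ⟨V, hx⟩ s) ∧
    H1.mk (dual M) 𝒰 c = b

end Modules

/-! ## Zariski-open subsets of a vector space -/

/-- The polynomial functions on a complex vector space. -/
def polynomialFunctions (V : Type*) [AddCommGroup V] [Module ℂ V] : Subalgebra ℂ (V → ℂ) :=
  Algebra.adjoin ℂ {f | ∃ φ : Module.Dual ℂ V, f = φ}

/-- A subset of a complex vector space is Zariski open if its complement is the common zero locus
of a set of polynomial functions. -/
def IsZariskiOpen {V : Type*} [AddCommGroup V] [Module ℂ V] (U : Set V) : Prop :=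
  ∃ S : Set (V → ℂ), S ⊆ polynomialFunctions V ∧ Uᶜ = {v | ∀ f ∈ S, f v = 0}

end CurveExt

end

/-! Taking global sections of the extension gives an exact sequence `0 → H⁰(𝒪) → H⁰(E_b) → H⁰(L) →
H¹(𝒪)` whose last map is the cup product with `b` (`Extension.exact_cup`). Since `H⁰(𝒪) = ℂ`, the
space `H⁰(E_b)` is a line exactly when the cup product is injective. This amounts to bijectivity
once `dim H⁰(L) = g`.

The equality `dim H⁰(L) = g` is obtained without Serre duality, by working with Weil's repartitions
over the function field `K`: for a divisor `D`, `H¹(D) = A / (A(D) + K)`. Multiplication by a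
nonzero `f ∈ L(E)` is invertible on repartitions, hence surjective `H¹(D) → H¹(D + E)`
(`mulH1_surjective`). If `H¹(D) ≠ 0`, a nonzero functional on it therefore embeds `L(D)` in the dual
of `H¹(0)`, so `ℓ(D) ≤ g` (`finrank_L_le`). For `deg D = 2g - 1` Riemann-Roch reads `ℓ(D) = g +
h¹(D)`, which forces `h¹(D) = 0`.

The same surjectivity gives genericity: for every `s ≠ 0` the map `b ↦ ⟨s, b⟩` is onto `H¹(𝒪)`. If a
cup product of maximal rank killed some `s ≠ 0`, a small perturbation moving `s` outside the image
would increase the rank (`exists_finrank_range_lt`). So some `b` gives an isomorphism, and the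
nonvanishing of a determinant is a Zariski-open condition.

The geometric part identifies sheaves on the curve with sheaves of rational functions with bounded
poles (`lineBundleModel`, `sheafHomModel`) and Čech cohomology with adelic cohomology
(`equivAdelic`). -/

noncomputable section

namespace CurveExt

/-! ### Linear systems of maps: rank and bijectivity -/

section LinearAlgebra

variable {A B W : Type*} [AddCommGroup A] [Module ℂ A] [AddCommGroup B] [Module ℂ B]
  [AddCommGroup W] [Module ℂ W] [FiniteDimensional ℂ A] [FiniteDimensional ℂ B]

/-- If `T` kills `s` and `S s` is not in the range of `T`, then some `T + t • S` has larger rank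
than `T`. -/
lemma exists_finrank_range_lt (T S : A →ₗ[ℂ] B) (s : A) (hs : T s = 0)
    (hS : S s ∉ LinearMap.range T) :
    ∃ t : ℂ, Module.finrank ℂ (LinearMap.range T) <
      Module.finrank ℂ (LinearMap.range (T + t • S)) := by
  let e := Module.finBasis ℂ (LinearMap.range T)
  choose v hv using fun i => (e i).2
  -- The `v i` lift a basis of the range of `T`. At `t = 0` the family consists of `S s` and this
  -- basis, so it is independent. For `t ≠ 0` it lies in the range of `T + t • S`, because `(T + t •
  -- S) (t⁻¹ • s) = S s`.
  let w : ℂ → Option (Fin (Module.finrank ℂ (LinearMap.range T))) → B :=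
    fun t o => o.elim (S s) fun i => (T + t • S) (v i)
  have h0 : LinearIndependent ℂ (w 0) := by
    refine linearIndependent_option.2 ⟨?_, ?_⟩
    · convert! e.linearIndependent.map' (LinearMap.range T).subtype (Submodule.ker_subtype _)
        using 1
      ext i
      simp [w, hv]
    · intro h
      refine hS (Submodule.span_le.2 ?_ h)
      rintro _ ⟨i, rfl⟩
      simp [w]
  have hw : ∃ t : ℂ, t ≠ 0 ∧ LinearIndependent ℂ (w t) := by
    -- `B` carries no topology. In coordinates, independence of a finite family is an open
    -- condition, so it persists for small nonzero `t`.
    let φ : B ≃ₗ[ℂ] (Fin (Module.finrank ℂ B) → ℂ) := (Module.finBasis ℂ B).equivFun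
    have key : ∀ t, LinearIndependent ℂ (w t) ↔ LinearIndependent ℂ (fun o => φ (w t o)) :=
      fun t => (φ.toLinearMap.linearIndependent_iff φ.ker).symm
    have hcont : Continuous fun (t : ℂ) (o : Option (Fin (Module.finrank ℂ (LinearMap.range T)))) =>
        φ (w t o) := by
      refine continuous_pi fun o => ?_
      cases o with
      | none => exact (continuous_const : Continuous fun _ : ℂ => φ (S s))
      | some i =>
        simp only [w, Option.elim, LinearMap.add_apply, LinearMap.smul_apply, map_add, map_smul]
        fun_prop
    have hopen := (isOpen_setOfPred_linearIndependent (𝕜 := ℂ) (E := Fin (Module.finrank ℂ B) → ℂ)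
      (ι := Option (Fin (Module.finrank ℂ (LinearMap.range T))))).preimage hcont
    have hmem : ∀ᶠ t in nhds (0 : ℂ), LinearIndependent ℂ (fun o => φ (w t o)) :=
      hopen.mem_nhds ((key 0).1 h0)
    obtain ⟨t, ht, ht0⟩ := ((hmem.filter_mono nhdsWithin_le_nhds).and
      (self_mem_nhdsWithin : {(0 : ℂ)}ᶜ ∈ nhdsWithin 0 {0}ᶜ)).exists
    exact ⟨t, ht0, (key t).2 ht⟩
  obtain ⟨t, ht, hw⟩ := hw
  refine ⟨t, ?_⟩
  have hr : ∀ o, w t o ∈ LinearMap.range (T + t • S) := by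
    rintro (_ | i)
    · exact ⟨t⁻¹ • s, by simp [w, hs, ht]⟩
    · exact ⟨v i, rfl⟩
  have := (LinearIndependent.of_comp (LinearMap.range (T + t • S)).subtype
    (v := fun o => (⟨w t o, hr o⟩ : LinearMap.range (T + t • S))) hw).fintype_card_le_finrank
  simp only [Fintype.card_option, Fintype.card_fin] at this
  omega

/-- A linear system of maps between spaces of equal dimension which moves every nonzero vector
onto the whole target contains an isomorphism. -/
lemma exists_bijective_of_forall_surjective (hAB : Module.finrank ℂ A = Module.finrank ℂ B)
    (β : W →ₗ[ℂ] A →ₗ[ℂ] B) (hβ : ∀ a ≠ 0, Function.Surjective fun w => β w a) :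
    ∃ w, Function.Bijective (β w) := by
  -- Take `w` of maximal rank. If `β w` were singular, it would kill some `s ≠ 0` and miss some `y =
  -- β w' s`, and a map `β (w + t • w')` would have larger rank.
  obtain ⟨w, hw⟩ : ∃ w, ∀ w', Module.finrank ℂ (LinearMap.range (β w')) ≤
      Module.finrank ℂ (LinearMap.range (β w)) := by
    have hb : BddAbove (Set.range fun w => Module.finrank ℂ (LinearMap.range (β w))) :=
      ⟨Module.finrank ℂ B, by rintro _ ⟨w, rfl⟩; exact Submodule.finrank_le _⟩
    obtain ⟨w, hw⟩ := Nat.sSup_mem (Set.range_nonempty _) hb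
    exact ⟨w, fun w' => (le_csSup hb ⟨w', rfl⟩).trans_eq hw.symm⟩
  refine ⟨w, ?_⟩
  have hinj : Function.Injective (β w) := by
    by_contra hinj
    have hsurj : ¬ Function.Surjective (β w) := fun h =>
      hinj ((LinearMap.injective_iff_surjective_of_finrank_eq_finrank hAB).2 h)
    rw [injective_iff_map_eq_zero] at hinj
    push Not at hinj
    obtain ⟨s, hs, hs0⟩ := hinj
    rw [Function.Surjective] at hsurj
    push Not at hsurj
    obtain ⟨y, hy⟩ := hsurj
    obtain ⟨w', rfl⟩ := hβ s hs0 y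
    obtain ⟨t, ht⟩ := exists_finrank_range_lt (β w) (β w') s hs (by simpa using hy)
    have := hw (w + t • w')
    rw [map_add, map_smul] at this
    omega
  exact ⟨hinj, (LinearMap.injective_iff_surjective_of_finrank_eq_finrank hAB).1 hinj⟩

/-- Bijectivity is a Zariski-open condition on a linear system of maps. -/
lemma isZariskiOpen_setOf_bijective (hAB : Module.finrank ℂ A = Module.finrank ℂ B)
    (β : W →ₗ[ℂ] A →ₗ[ℂ] B) : IsZariskiOpen {w | Function.Bijective (β w)} := by
  let a := Module.finBasis ℂ A
  let b := (Module.finBasis ℂ B).reindex (finCongr hAB.symm)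
  have hdet : ∀ w, Function.Bijective (β w) ↔ (LinearMap.toMatrix a b (β w)).det ≠ 0 := by
    intro w
    rw [← isUnit_iff_ne_zero, ← Matrix.isUnit_iff_isUnit_det]
    constructor
    · intro h
      let e := LinearEquiv.ofBijective _ h
      refine IsUnit.of_mul_eq_one (LinearMap.toMatrix b a e.symm.toLinearMap) ?_
      rw [← LinearMap.toMatrix_comp, ← LinearMap.toMatrix_id b]
      congr 1
      ext x
      exact e.apply_symm_apply x
    · intro h
      have h' : Function.Bijective (Matrix.toLin a b (LinearMap.toMatrix a b (β w))) := by
        obtain ⟨u, hu⟩ := h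
        have h1 := u.mul_inv
        have h2 := u.inv_mul
        rw [hu] at h1 h2
        refine Function.bijective_iff_has_inverse.2 ⟨Matrix.toLin b a (u⁻¹).1, fun x => ?_,
          fun x => ?_⟩
        · rw [← LinearMap.comp_apply, ← Matrix.toLin_mul, h2, Matrix.toLin_one,
            LinearMap.id_apply]
        · rw [← LinearMap.comp_apply, ← Matrix.toLin_mul, h1, Matrix.toLin_one,
            LinearMap.id_apply]
      rwa [Matrix.toLin_toMatrix] at h'
  -- One equation suffices: the determinant is a polynomial in the matrix entries, which are linear
  -- functionals of `w`.
  refine ⟨{fun w => (LinearMap.toMatrix a b (β w)).det}, ?_, ?_⟩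
  · rintro _ rfl
    have : (fun w => (LinearMap.toMatrix a b (β w)).det) =
        ∑ σ : Equiv.Perm (Fin (Module.finrank ℂ A)), (Equiv.Perm.sign σ : ℤ) •
          ∏ i, fun w => LinearMap.toMatrix a b (β w) (σ i) i := by
      ext w
      simp [Matrix.det_apply, Units.smul_def]
    rw [this]
    refine Subalgebra.sum_mem _ fun σ _ => Subalgebra.zsmul_mem _ (Subalgebra.prod_mem _
      fun i _ => Algebra.subset_adjoin ?_) _
    refine ⟨b.coord (σ i) ∘ₗ LinearMap.applyₗ (a i) ∘ₗ β, ?_⟩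
    ext w
    simp [LinearMap.toMatrix_apply]
  · ext w
    simp [hdet]

end LinearAlgebra

/-! ### Repartitions and adelic cohomology of a field with discrete valuations -/

/-- A field `K ⊇ ℂ` together with a family of discrete valuations with residue field `ℂ` such that
every nonzero element has finitely many zeros and poles. -/
structure ValuedField (P K : Type*) [Field K] [Algebra ℂ K] where
  ord : P → K → ℤ
  ord_mul : ∀ p f g, f ≠ 0 → g ≠ 0 → ord p (f * g) = ord p f + ord p g
  min_le_ord_add : ∀ p f g, f ≠ 0 → g ≠ 0 → f + g ≠ 0 → min (ord p f) (ord p g) ≤ ord p (f + g)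
  ord_algebraMap : ∀ p (c : ℂ), c ≠ 0 → ord p (algebraMap ℂ K c) = 0
  exists_ord_eq_one : ∀ p, ∃ t, t ≠ 0 ∧ ord p t = 1
  exists_residue : ∀ p f, f ≠ 0 → ord p f = 0 →
    ∃ c : ℂ, f = algebraMap ℂ K c ∨ 0 < ord p (f - algebraMap ℂ K c)
  finite_support : ∀ f, f ≠ 0 → {p | ord p f ≠ 0}.Finite

namespace ValuedField

variable {P K : Type*} [Field K] [Algebra ℂ K] (S : ValuedField P K)

/-- The elements of `K` with a pole of order at most `n` at `p`. -/
def poles (p : P) (n : ℤ) : Submodule ℂ K where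
  -- The value `ord p 0` is unconstrained, so zero is admitted by the premise `f ≠ 0`.
  carrier := {f | f ≠ 0 → -n ≤ S.ord p f}
  add_mem' {f g} hf hg hfg := by
    by_cases hf0 : f = 0
    · simp only [hf0, zero_add] at hfg ⊢
      exact hg hfg
    by_cases hg0 : g = 0
    · simp only [hg0, add_zero] at hfg ⊢
      exact hf hfg
    exact (le_min (hf hf0) (hg hg0)).trans (S.min_le_ord_add p f g hf0 hg0 hfg)
  zero_mem' h := absurd rfl h
  smul_mem' c f hf hcf := by
    rw [Algebra.smul_def] at hcf ⊢
    obtain ⟨hc, hf0⟩ := mul_ne_zero_iff.1 hcf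
    rw [S.ord_mul p _ _ hc hf0, S.ord_algebraMap p c (by rintro rfl; simp at hc), zero_add]
    exact hf hf0

lemma poles_mono (p : P) {m n : ℤ} (h : m ≤ n) : S.poles p m ≤ S.poles p n :=
  fun _ hf hf0 => (neg_le_neg h).trans (hf hf0)

lemma mul_mem_poles {p : P} {m n : ℤ} {f g : K} (hf : f ∈ S.poles p m) (hg : g ∈ S.poles p n) :
    f * g ∈ S.poles p (m + n) := by
  intro h
  obtain ⟨hf0, hg0⟩ := mul_ne_zero_iff.1 h
  rw [S.ord_mul p _ _ hf0 hg0]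
  have := hf hf0
  have := hg hg0
  omega

lemma eventually_ord_eq_zero {f : K} (hf : f ≠ 0) : ∀ᶠ p in Filter.cofinite, S.ord p f = 0 :=
  S.finite_support f hf

lemma ord_one (p : P) : S.ord p 1 = 0 := by
  simpa using S.ord_algebraMap p 1 one_ne_zero

lemma ord_inv (p : P) {f : K} (hf : f ≠ 0) : S.ord p f⁻¹ = - S.ord p f := by
  have := S.ord_mul p f f⁻¹ hf (inv_ne_zero hf)
  rw [mul_inv_cancel₀ hf, ord_one] at this
  omega

lemma exists_ord_eq (p : P) (n : ℤ) : ∃ u : K, u ≠ 0 ∧ S.ord p u = n := by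
  obtain ⟨t, ht, ht1⟩ := S.exists_ord_eq_one p
  have hpow : ∀ n : ℕ, S.ord p (t ^ n) = n := by
    intro n
    induction n with
    | zero => simp [ord_one]
    | succ n ih => rw [pow_succ, S.ord_mul p _ _ (pow_ne_zero n ht) ht, ih, ht1]; simp
  obtain ⟨m, rfl | rfl⟩ := n.eq_nat_or_neg
  · exact ⟨t ^ m, pow_ne_zero m ht, hpow m⟩
  · exact ⟨(t ^ m)⁻¹, inv_ne_zero (pow_ne_zero m ht), by
      rw [ord_inv S p (pow_ne_zero m ht), hpow m]⟩

/-- Repartitions: families of elements of `K`, almost all of them integral. -/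
def repartitions : Submodule ℂ (P → K) where
  carrier := {r | ∀ᶠ p in Filter.cofinite, r p ∈ S.poles p 0}
  add_mem' {r s} hr hs := by
    change ∀ᶠ p in Filter.cofinite, r p + s p ∈ S.poles p 0
    filter_upwards [hr, hs] with p hp hq using Submodule.add_mem _ hp hq
  zero_mem' := Filter.Eventually.of_forall (f := Filter.cofinite) fun _ => Submodule.zero_mem _
  smul_mem' c r hr := by
    change ∀ᶠ p in Filter.cofinite, c • r p ∈ S.poles p 0
    filter_upwards [hr] with p hp using Submodule.smul_mem _ _ hp

variable {S} in
lemma mem_repartitions {r : P → K} :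
    r ∈ S.repartitions ↔ ∀ᶠ p in Filter.cofinite, r p ∈ S.poles p 0 := Iff.rfl

variable {S} in
@[ext] lemma repartitions_ext {r s : S.repartitions} (h : ∀ p, r.1 p = s.1 p) : r = s :=
  Subtype.ext (funext h)

/-- The support of `D` is finite, so a bound by `D` is integrality at almost every point. -/
lemma mem_repartitions_of_forall {r : P → K} (D : P →₀ ℤ) (h : ∀ᶠ p in Filter.cofinite,
    r p ∈ S.poles p (D p)) : r ∈ S.repartitions := by
  have hD : ∀ᶠ p in Filter.cofinite, D p = 0 := D.hasFiniteSupport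
  rw [mem_repartitions]
  filter_upwards [h, hD] with p hp hp'
  rwa [hp'] at hp

/-- Constant repartitions. -/
def diag : K →ₗ[ℂ] S.repartitions where
  toFun f := ⟨fun _ => f, by
    rw [mem_repartitions]
    by_cases hf : f = 0
    · exact .of_forall fun p h => absurd hf h
    · filter_upwards [S.eventually_ord_eq_zero hf] with p hp _
      simp [hp]⟩
  map_add' _ _ := rfl
  map_smul' _ _ := rfl

@[simp] lemma diag_apply (f : K) (p : P) : (S.diag f).1 p = f := rfl

/-- Multiplication of repartitions by a constant. -/
def mulRep (f : K) : S.repartitions →ₗ[ℂ] S.repartitions where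
  toFun r := ⟨fun p => f * r.1 p, by
    rw [mem_repartitions]
    filter_upwards [(S.diag f).2, r.2] with p hp hp'
    simpa using S.mul_mem_poles hp hp'⟩
  map_add' r s := by ext p; exact mul_add _ _ _
  map_smul' c r := by ext p; exact mul_smul_comm _ _ _

@[simp] lemma mulRep_apply (f : K) (r : S.repartitions) (p : P) :
    (S.mulRep f r).1 p = f * r.1 p := rfl

lemma mulRep_surjective {f : K} (hf : f ≠ 0) : Function.Surjective (S.mulRep f) := fun r =>
  ⟨S.mulRep f⁻¹ r, by ext p; simp [hf]⟩

/-- Repartitions with poles bounded by `D`. -/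
def boundedRep (D : P → ℤ) : Submodule ℂ S.repartitions where
  carrier := {r | ∀ p, r.1 p ∈ S.poles p (D p)}
  add_mem' hr hs p := Submodule.add_mem _ (hr p) (hs p)
  zero_mem' _ := Submodule.zero_mem _
  smul_mem' _ _ hr p := Submodule.smul_mem _ _ (hr p)

lemma boundedRep_mono {D D' : P → ℤ} (h : D ≤ D') : S.boundedRep D ≤ S.boundedRep D' :=
  fun _ hr p => S.poles_mono p (h p) (hr p)

/-- The Riemann-Roch space of `D`. -/
def L (D : P → ℤ) : Submodule ℂ K := (S.boundedRep D).comap S.diag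

/-- The sum of the repartitions bounded by `D` and the constant ones. -/
def adelicBoundaries (D : P → ℤ) : Submodule ℂ S.repartitions :=
  S.boundedRep D ⊔ LinearMap.range S.diag

/-- The adelic first cohomology group of `D`. -/
abbrev AdelicH1 (D : P → ℤ) : Type _ := S.repartitions ⧸ S.adelicBoundaries D

lemma mulRep_mem_boundedRep {D E G : P → ℤ} {f : K} (hf : f ∈ S.L E) (hG : D + E = G)
    {r : S.repartitions} (hr : r ∈ S.boundedRep D) : S.mulRep f r ∈ S.boundedRep G := by
  intro p
  rw [← hG, Pi.add_apply, add_comm]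
  exact S.mul_mem_poles (hf p) (hr p)

lemma adelicBoundaries_le_comap_mulRep {D E G : P → ℤ} {f : K} (hf : f ∈ S.L E)
    (hG : D + E = G) :
    S.adelicBoundaries D ≤ (S.adelicBoundaries G).comap (S.mulRep f) := by
  refine sup_le (fun r hr => Submodule.mem_sup_left (S.mulRep_mem_boundedRep hf hG hr)) ?_
  rintro _ ⟨g, rfl⟩
  exact Submodule.mem_sup_right ⟨f * g, rfl⟩

/-- Multiplication `H¹(D) → H¹(D + E)` by an element of `L(E)`. -/
def mulH1 {D E G : P → ℤ} (hG : D + E = G) (f : S.L E) : S.AdelicH1 D →ₗ[ℂ] S.AdelicH1 G :=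
  Submodule.mapQ _ _ (S.mulRep f.1) (S.adelicBoundaries_le_comap_mulRep f.2 hG)

@[simp] lemma mulH1_mk {D E G : P → ℤ} (hG : D + E = G) (f : S.L E) (r : S.repartitions) :
    S.mulH1 hG f (Submodule.Quotient.mk r) = Submodule.Quotient.mk (S.mulRep f.1 r) := rfl

/-- Repartitions form a `K`-vector space, so a nonzero `f` acts on them invertibly, and surjectivity
passes to the quotients. Geometrically, the cokernel of multiplication by a section has finite
support, hence no `H¹`. -/
lemma mulH1_surjective {D E G : P → ℤ} (hG : D + E = G) {f : S.L E} (hf : f ≠ 0) :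
    Function.Surjective (S.mulH1 hG f) := by
  intro q
  obtain ⟨r, rfl⟩ := Submodule.Quotient.mk_surjective _ q
  obtain ⟨s, rfl⟩ := S.mulRep_surjective (f := f.1) (by simpa using hf) r
  exact ⟨Submodule.Quotient.mk s, rfl⟩

/-- The pairing `L(E) × H¹(D) → H¹(D + E)`. -/
def pairing {D E G : P → ℤ} (hG : D + E = G) :
    S.AdelicH1 D →ₗ[ℂ] S.L E →ₗ[ℂ] S.AdelicH1 G :=
  LinearMap.flip
    { toFun := S.mulH1 hG
      map_add' := fun f g => by
        refine LinearMap.ext fun q => ?_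
        obtain ⟨r, rfl⟩ := Submodule.Quotient.mk_surjective _ q
        simp only [LinearMap.add_apply, mulH1_mk, ← Submodule.Quotient.mk_add]
        congr 1
        ext p
        exact add_mul _ _ _
      map_smul' := fun c f => by
        refine LinearMap.ext fun q => ?_
        obtain ⟨r, rfl⟩ := Submodule.Quotient.mk_surjective _ q
        simp only [LinearMap.smul_apply, mulH1_mk, ← Submodule.Quotient.mk_smul]
        congr 1
        ext p
        exact smul_mul_assoc _ _ _ }

end ValuedField

/-! ### Dimension counts on adjoining one vector -/

section Dimension

variable {V : Type*} [AddCommGroup V] [Module ℂ V] {N : Submodule ℂ V} {x : V}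

lemma finite_sup_span_singleton_iff :
    Module.Finite ℂ ↥(N ⊔ Submodule.span ℂ {x}) ↔ Module.Finite ℂ N :=
  ⟨fun _ => Submodule.finiteDimensional_of_le (le_sup_left : N ≤ N ⊔ Submodule.span ℂ {x}),
    fun _ => inferInstance⟩

lemma finrank_sup_span_singleton_of_notMem [Module.Finite ℂ N] (hx : x ∉ N) :
    Module.finrank ℂ ↥(N ⊔ Submodule.span ℂ {x}) = Module.finrank ℂ N + 1 := by
  have h0 : x ≠ 0 := by rintro rfl; exact hx N.zero_mem
  have h := Submodule.finrank_sup_add_finrank_inf_eq N (Submodule.span ℂ {x})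
  rw [((Submodule.disjoint_span_singleton' h0).2 hx).eq_bot, finrank_bot,
    finrank_span_singleton h0] at h
  simpa using h

lemma finite_quotient_sup_span_singleton_iff :
    Module.Finite ℂ (V ⧸ (N ⊔ Submodule.span ℂ {x})) ↔ Module.Finite ℂ (V ⧸ N) := by
  have e := Submodule.quotientQuotientEquivQuotientSup N (Submodule.span ℂ {x})
  constructor
  · intro _
    have : Module.Finite ℂ ((V ⧸ N) ⧸ (Submodule.span ℂ {x}).map N.mkQ) := Module.Finite.equiv e.symm
    have : Module.Finite ℂ ((Submodule.span ℂ {x}).map N.mkQ) := inferInstance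
    exact Module.Finite.of_submodule_quotient ((Submodule.span ℂ {x}).map N.mkQ)
  · intro _
    exact Module.Finite.equiv e

lemma finrank_quotient_of_notMem [Module.Finite ℂ (V ⧸ N)] (hx : x ∉ N) :
    Module.finrank ℂ (V ⧸ N) = Module.finrank ℂ (V ⧸ (N ⊔ Submodule.span ℂ {x})) + 1 := by
  have e := Submodule.quotientQuotientEquivQuotientSup N (Submodule.span ℂ {x})
  have h := Submodule.finrank_quotient_add_finrank ((Submodule.span ℂ {x}).map N.mkQ)
  rw [e.finrank_eq] at h
  rw [← h, Submodule.map_span, Set.image_singleton, finrank_span_singleton]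
  simpa using hx

end Dimension

/-! ### The Riemann-Roch formula -/

namespace ValuedField

variable {P K : Type*} [Field K] [Algebra ℂ K] (S : ValuedField P K)

open Classical in
/-- Bounding the poles by one more point adds at most one dimension. -/
lemma exists_boundedRep_add_single (D : P →₀ ℤ) (p : P) :
    ∃ e : S.repartitions, e ∉ S.boundedRep D ∧
      S.boundedRep (D + Finsupp.single p 1 : P →₀ ℤ) = S.boundedRep D ⊔ Submodule.span ℂ {e} := by
  -- A function with pole of order exactly `D p + 1` at `p`. The repartition `e` equal to `u` at `p`
  -- and zero elsewhere spans the new dimension.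
  obtain ⟨u, hu, hu1⟩ := S.exists_ord_eq p (-(D p + 1))
  have hle : (⇑D : P → ℤ) ≤ (D + Finsupp.single p 1 : P →₀ ℤ) := by
    intro q
    change D q ≤ D q + Finsupp.single p 1 q
    have : 0 ≤ Finsupp.single p (1 : ℤ) q := by
      rw [Finsupp.single_apply]; split_ifs <;> simp
    omega
  have hpole : ∀ q, Pi.single (M := fun _ => K) p u q ∈ S.poles q ((D + Finsupp.single p 1 : P →₀ ℤ) q) := by
    intro q
    by_cases hq : q = p
    · subst hq
      intro _
      simp [hu1]
    · simp [hq]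
  let e : S.repartitions := ⟨Pi.single p u, S.mem_repartitions_of_forall _ (.of_forall hpole)⟩
  refine ⟨e, fun h => ?_, le_antisymm (fun r hr => ?_)
    (sup_le (S.boundedRep_mono hle) ((Submodule.span_singleton_le_iff_mem _ _).2 hpole))⟩
  · have := h p
    simp only [e, Pi.single_eq_same] at this
    have := this hu
    omega
  · obtain ⟨c, hc⟩ : ∃ c : ℂ, r.1 p - c • u ∈ S.poles p (D p) := by
      by_cases hr0 : r.1 p = 0
      · exact ⟨0, by simp [hr0]⟩
      have hrp := hr p hr0
      simp only [Finsupp.coe_add, Pi.add_apply, Finsupp.single_eq_same] at hrp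
      -- If `r p` attains the maximal pole order, then `r p / u` is a unit at `p`. Subtracting its
      -- residue times `u` lowers the pole order.
      rcases eq_or_lt_of_le hrp with hrp | hrp
      · have hdiv : S.ord p (r.1 p * u⁻¹) = 0 := by
          rw [S.ord_mul p _ _ hr0 (inv_ne_zero hu), S.ord_inv p hu]
          omega
        obtain ⟨c, hc⟩ := S.exists_residue p _ (mul_ne_zero hr0 (inv_ne_zero hu)) hdiv
        refine ⟨c, ?_⟩
        have heq : r.1 p - c • u = (r.1 p * u⁻¹ - algebraMap ℂ K c) * u := by
          rw [sub_mul, inv_mul_cancel_right₀ hu, Algebra.smul_def]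
        intro h
        rw [heq] at h ⊢
        obtain ⟨h1, -⟩ := mul_ne_zero_iff.1 h
        rw [S.ord_mul p _ _ h1 hu, hu1]
        rcases hc with hc | hc
        · exact absurd (sub_eq_zero.2 hc) h1
        · omega
      · exact ⟨0, fun _ => by simp only [zero_smul, sub_zero]; omega⟩
    refine Submodule.mem_sup.2 ⟨r - c • e, fun q => ?_, c • e,
      Submodule.smul_mem _ _ (Submodule.mem_span_singleton_self e), by simp⟩
    by_cases hq : q = p
    · subst hq
      simpa [e] using hc
    · have := hr q
      simp only [Finsupp.coe_add, Pi.add_apply, Finsupp.single_eq_of_ne hq, add_zero] at this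
      simpa [e, hq] using this

/-- The Riemann-Roch formula for `D`, relative to the constant `χ`. -/
def RiemannRoch (χ : ℤ) (D : P →₀ ℤ) : Prop :=
  Module.Finite ℂ (S.L D) ∧ Module.Finite ℂ (S.AdelicH1 D) ∧
    (Module.finrank ℂ (S.L D) : ℤ) - Module.finrank ℂ (S.AdelicH1 D) = χ + D.sum fun _ n => n

/-- With `A(D + p) = A(D) ⊕ ℂe`, there are two cases. If `e ∈ A(D) + K`, then `L` gains one
dimension and `H¹` is unchanged. Otherwise `L` is unchanged and `H¹` loses one dimension. Either way
`ℓ - h¹` grows by one, as the degree does. An equivalence is needed in order to subtract points as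
well. -/
lemma riemannRoch_add_single_iff (χ : ℤ) (D : P →₀ ℤ) (p : P) :
    S.RiemannRoch χ (D + Finsupp.single p 1) ↔ S.RiemannRoch χ D := by
  classical
  obtain ⟨e, he, hD⟩ := S.exists_boundedRep_add_single D p
  have hdeg : (D + Finsupp.single p 1).sum (fun _ n => n) = D.sum (fun _ n => n) + 1 := by
    rw [Finsupp.sum_add_index' (fun _ => rfl) (fun _ _ _ => rfl), Finsupp.sum_single_index rfl]
  by_cases h : e ∈ S.adelicBoundaries D
  -- The constant part `k` of `e` is the new element of the Riemann-Roch space.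
  · obtain ⟨a, ha, _, ⟨k, rfl⟩, hk⟩ := Submodule.mem_sup.1 h
    have hk' : k ∉ S.L D := fun hkD => he (hk ▸ Submodule.add_mem _ ha hkD)
    have hH : S.adelicBoundaries (D + Finsupp.single p 1 : P →₀ ℤ) = S.adelicBoundaries D := by
      rw [adelicBoundaries, hD, sup_right_comm]
      exact sup_eq_left.2 ((Submodule.span_singleton_le_iff_mem _ _).2 h)
    have hL : S.L (D + Finsupp.single p 1 : P →₀ ℤ) = S.L D ⊔ Submodule.span ℂ {k} := by
      refine le_antisymm (fun f hf => ?_) (sup_le ?_ ?_)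
      · have hf' : S.diag f ∈ S.boundedRep D ⊔ Submodule.span ℂ {e} := hD ▸ hf
        obtain ⟨a', ha', y, hy, hf'⟩ := Submodule.mem_sup.1 hf'
        obtain ⟨c, rfl⟩ := Submodule.mem_span_singleton.1 hy
        refine Submodule.mem_sup.2 ⟨f - c • k, ?_, c • k,
          Submodule.smul_mem _ _ (Submodule.mem_span_singleton_self k), by simp⟩
        change S.diag (f - c • k) ∈ S.boundedRep D
        have : S.diag (f - c • k) = a' + c • a := by
          rw [map_sub, map_smul, ← hf', ← hk, smul_add]
          abel
        rw [this]
        exact Submodule.add_mem _ ha' (Submodule.smul_mem _ _ ha)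
      · exact Submodule.comap_mono (hD ▸ le_sup_left)
      · rw [Submodule.span_singleton_le_iff_mem]
        change S.diag k ∈ S.boundedRep _
        rw [hD, ← add_sub_cancel_left a (S.diag k), hk]
        exact Submodule.sub_mem _ (Submodule.mem_sup_right (Submodule.mem_span_singleton_self e))
          (Submodule.mem_sup_left ha)
    unfold RiemannRoch AdelicH1
    rw [hH, hL, finite_sup_span_singleton_iff, hdeg]
    refine and_congr_right fun _ => and_congr_right fun _ => ?_
    rw [finrank_sup_span_singleton_of_notMem hk']
    push_cast
    omega
  · have hH : S.adelicBoundaries (D + Finsupp.single p 1 : P →₀ ℤ) =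
        S.adelicBoundaries D ⊔ Submodule.span ℂ {e} := by
      rw [adelicBoundaries, hD, sup_right_comm]
      rfl
    have hL : S.L (D + Finsupp.single p 1 : P →₀ ℤ) = S.L D := by
      refine le_antisymm (fun f hf => ?_) (Submodule.comap_mono (hD ▸ le_sup_left))
      have hf' : S.diag f ∈ S.boundedRep D ⊔ Submodule.span ℂ {e} := hD ▸ hf
      obtain ⟨a', ha', y, hy, hf'⟩ := Submodule.mem_sup.1 hf'
      obtain ⟨c, rfl⟩ := Submodule.mem_span_singleton.1 hy
      -- A nonzero `c` would express `e` through `f` and `a'`, putting it in `A(D) + K`.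
      have hc : c = 0 := by
        by_contra hc
        refine h ?_
        have : e = c⁻¹ • (S.diag f - a') := by
          rw [← hf', add_sub_cancel_left, inv_smul_smul₀ hc]
        rw [this]
        exact Submodule.smul_mem _ _ (Submodule.sub_mem _ (Submodule.mem_sup_right ⟨f, rfl⟩)
          (Submodule.mem_sup_left ha'))
      change S.diag f ∈ S.boundedRep D
      rw [← hf', hc, zero_smul, add_zero]
      exact ha'
    unfold RiemannRoch AdelicH1
    rw [hH, hL, finite_quotient_sup_span_singleton_iff, hdeg]
    refine and_congr_right fun _ => and_congr_right fun _ => ?_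
    rw [finrank_quotient_of_notMem h]
    push_cast
    omega

lemma riemannRoch_add_single_int_iff (χ : ℤ) (D : P →₀ ℤ) (p : P) (n : ℤ) :
    S.RiemannRoch χ (D + Finsupp.single p n) ↔ S.RiemannRoch χ D := by
  induction n with
  | zero => simp
  | succ i ih => rw [Finsupp.single_add, ← add_assoc, riemannRoch_add_single_iff, ih]
  | pred i ih =>
    rw [← ih, ← riemannRoch_add_single_iff, add_assoc, ← Finsupp.single_add, sub_add_cancel]

/-- The Riemann-Roch formula. -/
lemma riemannRoch [Module.Finite ℂ (S.L 0)] [Module.Finite ℂ (S.AdelicH1 0)] (D : P →₀ ℤ) :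
    S.RiemannRoch (Module.finrank ℂ (S.L 0) - Module.finrank ℂ (S.AdelicH1 0)) D := by
  induction D using Finsupp.induction with
  | zero => exact ⟨‹_›, ‹_›, by simp⟩
  | single_add p n D _ _ ih =>
    rwa [add_comm, riemannRoch_add_single_int_iff]

variable {S} in
/-- If `H¹(D)` does not vanish then `dim L(D) ≤ dim H¹(0)`. -/
lemma finrank_L_le [Module.Finite ℂ (S.AdelicH1 0)] {D : P → ℤ} [Nontrivial (S.AdelicH1 D)] :
    Module.finrank ℂ (S.L D) ≤ Module.finrank ℂ (S.AdelicH1 0) := by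
  obtain ⟨q, hq⟩ := exists_ne (0 : S.AdelicH1 D)
  obtain ⟨l, hl⟩ : ∃ l : Module.Dual ℂ (S.AdelicH1 D), l q ≠ 0 := by
    by_contra! h
    exact hq ((Module.forall_dual_apply_eq_zero_iff ℂ q).1 h)
  -- Here `φ f` is the functional `q' ↦ l (f q')`. For `f ≠ 0` multiplication by `f` reaches `q`,
  -- where `l` does not vanish, so `φ` is injective.
  let φ : S.L D →ₗ[ℂ] Module.Dual ℂ (S.AdelicH1 0) :=
    (S.pairing (zero_add D)).flip.compr₂ l
  have hφ : Function.Injective φ := by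
    rw [injective_iff_map_eq_zero]
    intro f hf
    by_contra hf0
    obtain ⟨q', rfl⟩ := S.mulH1_surjective (zero_add D) hf0 q
    exact hl (LinearMap.congr_fun hf q')
  rw [← Subspace.dual_finrank_eq (K := ℂ) (V := S.AdelicH1 0)]
  exact LinearMap.finrank_le_finrank_of_injective hφ

/-- If `deg D ≥ 2g - 1` then `H¹(D) = 0`, so that `dim L(D) = deg D + 1 - g`. -/
lemma finrank_L_eq [Module.Finite ℂ (S.L 0)] [Module.Finite ℂ (S.AdelicH1 0)]
    (h0 : Module.finrank ℂ (S.L 0) = 1) (D : P →₀ ℤ)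
    (hD : D.sum (fun _ n => n) = 2 * (Module.finrank ℂ (S.AdelicH1 0) : ℤ) - 1) :
    Module.finrank ℂ (S.L D) = Module.finrank ℂ (S.AdelicH1 0) := by
  obtain ⟨_, _, h⟩ := S.riemannRoch D
  rw [hD, h0] at h
  -- Riemann-Roch now says `ℓ(D) = g + h¹(D)`, while `H¹(D) ≠ 0` would force `ℓ(D) ≤ g`.
  rcases subsingleton_or_nontrivial (S.AdelicH1 D) with _ | _
  · rw [Module.finrank_zero_of_subsingleton (M := S.AdelicH1 D)] at h
    push_cast at h
    omega
  · have := finrank_L_le (S := S) (D := D)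
    have : 0 < Module.finrank ℂ (S.AdelicH1 D) := Module.finrank_pos
    omega

end ValuedField

/-! ### Čech cohomology equals adelic cohomology -/

section CechComparison

variable {X : TopCat.{0}}

/-- This is what makes a class that vanishes in the colimit vanish already on some refinement. -/
instance (F : CPresheaf X) :
    DirectedSystem (CechH1 F) fun _ _ h => CechH1.res F _ _ h where
  map_self 𝒰 q := by
    obtain ⟨c, rfl⟩ := CechH1.mk_surjective F 𝒰 q
    refine congrArg (CechH1.mk F 𝒰) ?_
    ext x y
    exact res_self F _ _
  map_map 𝒰 𝒱 𝒲 h h' q := by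
    obtain ⟨c, rfl⟩ := CechH1.mk_surjective F _ q
    refine congrArg (CechH1.mk F _) ?_
    ext x y
    exact res_res F _ _ _

lemma H1.mk_eq_zero_iff {F : CPresheaf X} (𝒰 : PointedCover X) (c : cocycles F 𝒰) :
    H1.mk F 𝒰 c = 0 ↔ ∃ 𝒱, ∃ h : 𝒰 ≤ 𝒱, ∃ s, coboundary F 𝒱 s = cocyclesRes F h c := by
  classical
  constructor
  · intro h
    obtain ⟨𝒱, h𝒱, h⟩ := Module.DirectLimit.of.zero_exact h
    have h' : CechH1.mk F 𝒱 (cocyclesRes F h𝒱 c) = 0 := h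
    obtain ⟨s, hs⟩ := (Submodule.Quotient.mk_eq_zero _).1 h'
    exact ⟨𝒱, h𝒱, s, hs⟩
  · rintro ⟨𝒱, h, s, hs⟩
    have h1 : CechH1.res F 𝒰 𝒱 h (CechH1.mk F 𝒰 c) = 0 :=
      (Submodule.Quotient.mk_eq_zero _).2 ⟨s, hs⟩
    change Module.DirectLimit.of ℂ (PointedCover X) (CechH1 F) (CechH1.res F) 𝒰
      (CechH1.mk F 𝒰 c) = 0
    rw [← Module.DirectLimit.of_f (hij := h), h1, map_zero]

/-- `η` is a generic point of `X`, and the closed subsets of `X` not containing it are the finite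
ones. -/
structure IsCurveGenericPoint (η : X) : Prop where
  specializes : ∀ x, η ⤳ x
  isClosed_iff : ∀ s : Set X, η ∉ s → (IsClosed s ↔ s.Finite)

lemma IsCurveGenericPoint.mem {η : X} (h : IsCurveGenericPoint η) {U : Opens X} {x : X}
    (hx : x ∈ U) : η ∈ U :=
  (h.specializes x).mem_open U.isOpen hx

lemma IsCurveGenericPoint.mem_nhd_inf {η : X} (h : IsCurveGenericPoint η) (𝒰 : PointedCover X)
    (x y : X) : η ∈ 𝒰.nhd x ⊓ 𝒰.nhd y :=
  Opens.mem_inf.2 ⟨h.mem (𝒰.mem x), h.mem (𝒰.mem y)⟩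

lemma IsCurveGenericPoint.mem_nhd {η : X} (h : IsCurveGenericPoint η) (𝒰 : PointedCover X)
    (x : X) : η ∈ 𝒰.nhd x :=
  h.mem (𝒰.mem x)

variable {η : X} {K : Type} [Field K] [Algebra ℂ K] (S : ValuedField {x : X // x ≠ η} K)

/-- An identification of the presheaf `F` with the sheaf of elements of `K` with poles bounded by
`D`. -/
structure SectionModel (F : CPresheaf X) (D : {x : X // x ≠ η} →₀ ℤ) where
  val : ∀ U : Opens X, η ∈ U → F.obj (.op U) →ₗ[ℂ] K
  injective : ∀ U hU, Function.Injective (val U hU)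
  exists_iff : ∀ U hU k, (∃ s, val U hU s = k) ↔
    ∀ p : {x : X // x ≠ η}, p.1 ∈ U → k ∈ S.poles p (D p)
  val_res : ∀ {U V : Opens X} (h : V ≤ U) (hV : η ∈ V) (s : F.obj (.op U)),
    val V hV (res F h s) = val U (h hV) s

namespace SectionModel

attribute [simp] val_res

variable {S} {F : CPresheaf X} {D : {x : X // x ≠ η} →₀ ℤ} (M : SectionModel S F D)
  (hη : IsCurveGenericPoint η)

lemma val_mem {U : Opens X} (hU : η ∈ U) (s : F.obj (.op U)) (p : {x : X // x ≠ η})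
    (hp : p.1 ∈ U) : M.val U hU s ∈ S.poles p (D p) :=
  (M.exists_iff U hU _).1 ⟨s, rfl⟩ p hp

/-- A section with a given value. -/
def lift {U : Opens X} (hU : η ∈ U) (k : K)
    (hk : ∀ p : {x : X // x ≠ η}, p.1 ∈ U → k ∈ S.poles p (D p)) : F.obj (.op U) :=
  ((M.exists_iff U hU k).2 hk).choose

@[simp] lemma val_lift {U : Opens X} (hU : η ∈ U) (k : K)
    (hk : ∀ p : {x : X // x ≠ η}, p.1 ∈ U → k ∈ S.poles p (D p)) :
    M.val U hU (M.lift hU k hk) = k :=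
  ((M.exists_iff U hU k).2 hk).choose_spec

/-- Global sections are the Riemann-Roch space of `D`. -/
def globalSections : F.obj (.op ⊤) ≃ₗ[ℂ] S.L D :=
  LinearEquiv.ofBijective ((M.val ⊤ (Opens.mem_top η)).codRestrict (S.L D) fun s p =>
      M.val_mem (Opens.mem_top η) s p (Opens.mem_top _))
    ⟨fun _ _ h => M.injective ⊤ (Opens.mem_top η) (congr($h.1)), fun k =>
      ⟨M.lift (Opens.mem_top η) k.1 fun p _ => k.2 p, Subtype.ext (M.val_lift _ _ _)⟩⟩

/-- The value of a cochain. -/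
def cochainVal {𝒰 : PointedCover X} (c : ∀ x y, F.obj (.op (𝒰.nhd x ⊓ 𝒰.nhd y))) (x y : X) : K :=
  M.val _ (hη.mem_nhd_inf 𝒰 x y) (c x y)

lemma cochainVal_cocycle {𝒰 : PointedCover X} (c : cocycles F 𝒰) (x y z : X) :
    M.cochainVal hη c.1 x z = M.cochainVal hη c.1 x y + M.cochainVal hη c.1 y z := by
  have hV : η ∈ 𝒰.nhd x ⊓ (𝒰.nhd y ⊓ 𝒰.nhd z) :=
    Opens.mem_inf.2 ⟨hη.mem_nhd 𝒰 x, hη.mem_nhd_inf 𝒰 y z⟩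
  have h := congr(M.val _ hV $(c.2 x y z _ inf_le_left (inf_le_right.trans inf_le_left)
    (inf_le_right.trans inf_le_right)))
  simp only [map_add, val_res] at h
  exact h

/-- The repartition attached to a cocycle. -/
def repartition (𝒰 : PointedCover X) : cocycles F 𝒰 →ₗ[ℂ] S.repartitions where
  -- The covering has a member `U_η` for the generic point, containing all but finitely many points.
  -- For `p` in it, `c η p` is a section defined at `p`, so its value is bounded by `D p`.
  toFun c := ⟨fun p => M.cochainVal hη c.1 η p.1, by
    have hfin : ((𝒰.nhd η : Set X)ᶜ).Finite :=
      (hη.isClosed_iff _ (Set.notMem_compl_iff.2 (𝒰.mem η))).1 (𝒰.nhd η).isOpen.isClosed_compl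
    refine S.mem_repartitions_of_forall D ?_
    have : ∀ᶠ p : {x : X // x ≠ η} in Filter.cofinite, p.1 ∈ 𝒰.nhd η := by
      rw [Filter.eventually_cofinite]
      exact hfin.preimage Subtype.val_injective.injOn
    filter_upwards [this] with p hp
    exact M.val_mem _ _ p (Opens.mem_inf.2 ⟨hp, 𝒰.mem p.1⟩)⟩
  map_add' c d := by
    ext p
    exact map_add (M.val _ _) _ _
  map_smul' a c := by
    ext p
    exact map_smul (M.val _ _) _ _

/-- Here `c η p = s p - s η`: the first term is bounded by `D` at `p`, and the second is a fixed
rational function. -/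
lemma repartition_coboundary (𝒰 : PointedCover X) (s : ∀ x, F.obj (.op (𝒰.nhd x))) :
    M.repartition hη 𝒰 (coboundary F 𝒰 s) ∈ S.adelicBoundaries D := by
  have hs : ∀ p : {x : X // x ≠ η}, M.val _ (hη.mem_nhd 𝒰 p.1) (s p.1) ∈ S.poles p (D p) :=
    fun p => M.val_mem _ _ p (𝒰.mem p.1)
  refine Submodule.mem_sup.2 ⟨⟨fun p => M.val _ (hη.mem_nhd 𝒰 p.1) (s p.1),
    S.mem_repartitions_of_forall D (.of_forall hs)⟩, hs, _,
    ⟨-M.val _ (hη.mem_nhd 𝒰 η) (s η), rfl⟩, ?_⟩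
  ext p
  change M.val _ _ _ + - M.val _ _ _ = M.val _ _ (res F _ _ - res F _ _)
  rw [map_sub, val_res, val_res, sub_eq_add_neg]

lemma repartition_cocyclesRes {𝒰 𝒱 : PointedCover X} (h : 𝒰 ≤ 𝒱) (c : cocycles F 𝒰) :
    M.repartition hη 𝒱 (cocyclesRes F h c) = M.repartition hη 𝒰 c := by
  ext p
  exact M.val_res _ _ _

open Classical in
/-- The comparison map from Čech to adelic cohomology. -/
def toAdelic : H1 F →ₗ[ℂ] S.AdelicH1 D :=
  Module.DirectLimit.lift ℂ (PointedCover X) (CechH1 F) (CechH1.res F)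
    (fun 𝒰 => Submodule.liftQ _ ((S.adelicBoundaries D).mkQ ∘ₗ M.repartition hη 𝒰) (by
      rintro _ ⟨s, rfl⟩
      simpa using M.repartition_coboundary hη 𝒰 s))
    (by
      intro 𝒰 𝒱 h q
      obtain ⟨c, rfl⟩ := CechH1.mk_surjective F 𝒰 q
      exact congr((S.adelicBoundaries D).mkQ $(M.repartition_cocyclesRes hη h c)))

lemma toAdelic_mk (𝒰 : PointedCover X) (c : cocycles F 𝒰) :
    M.toAdelic hη (H1.mk F 𝒰 c) = Submodule.Quotient.mk (M.repartition hη 𝒰 c) := by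
  classical
  exact Module.DirectLimit.lift_of _ _ _

variable (D) in
/-- The points where the repartition `r` is not bounded by `D`. -/
def badPoints (r : S.repartitions) : Set X :=
  {x : X | ∃ h : x ≠ η, r.1 ⟨x, h⟩ ∉ S.poles ⟨x, h⟩ (D ⟨x, h⟩)}

lemma mem_badPoints {r : S.repartitions} {x : X} :
    x ∈ badPoints D r ↔ ∃ h : x ≠ η, r.1 ⟨x, h⟩ ∉ S.poles ⟨x, h⟩ (D ⟨x, h⟩) := Iff.rfl

lemma coe_notMem_badPoints {r : S.repartitions} {p : {x : X // x ≠ η}} :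
    p.1 ∉ badPoints D r ↔ r.1 p ∈ S.poles p (D p) := by
  rw [mem_badPoints, not_exists]
  exact ⟨fun h => not_not.1 (h p.2), fun h _ => not_not.2 h⟩

lemma generic_notMem_badPoints (r : S.repartitions) : η ∉ badPoints D r := by
  rw [mem_badPoints]
  exact fun h => h.1 rfl

lemma finite_badPoints (r : S.repartitions) : (badPoints D r).Finite := by
  have hD : ∀ᶠ p in Filter.cofinite, D p = 0 := D.hasFiniteSupport
  have hr : ∀ᶠ p in Filter.cofinite, r.1 p ∈ S.poles p (D p) := by
    filter_upwards [r.2, hD] with p hp hp'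
    rwa [hp']
  rw [Filter.eventually_cofinite] at hr
  refine (hr.image Subtype.val).subset ?_
  rintro x ⟨h, hx⟩
  exact ⟨⟨x, h⟩, hx, rfl⟩

/-- The open complement of a finite set not containing the generic point. -/
def complOpen {s : Set X} (hs : s.Finite) (hs' : η ∉ s) : Opens X :=
  ⟨sᶜ, ((hη.isClosed_iff s hs').2 hs).isOpen_compl⟩

lemma mem_complOpen {s : Set X} (hs : s.Finite) (hs' : η ∉ s) {x : X} :
    x ∈ complOpen hη hs hs' ↔ x ∉ s := Iff.rfl

/-- If `c η p = m p + k` with `m` bounded by `D`, put `f x = c η x - k`. The cocycle relation gives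
`f y - f x = c x y`. Since `f x` has an admissible pole at `x`, it is a section near `x`, after
removing finitely many other points. So `f` is a cochain bounding `c` on a refinement. -/
lemma toAdelic_injective : Function.Injective (M.toAdelic hη) := by
  rw [injective_iff_map_eq_zero]
  intro b hb
  obtain ⟨𝒰, c, rfl⟩ := H1.exists_mk b
  rw [toAdelic_mk, Submodule.Quotient.mk_eq_zero] at hb
  obtain ⟨m, hm, _, ⟨k, rfl⟩, hmk⟩ := Submodule.mem_sup.1 hb
  rw [H1.mk_eq_zero_iff]
  let f : X → K := fun x => M.cochainVal hη c.1 η x - k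
  have hx : ∀ x, x ∉ badPoints D (S.diag (f x)) := by
    intro x
    by_cases h : x = η
    · rw [h]
      exact generic_notMem_badPoints _
    refine (coe_notMem_badPoints (p := ⟨x, h⟩)).2 ?_
    have h1 : m.1 ⟨x, h⟩ + k = M.cochainVal hη c.1 η x := congr($hmk.1 ⟨x, h⟩)
    have h2 : f x = m.1 ⟨x, h⟩ := by simp only [f, ← h1, add_sub_cancel_right]
    rw [ValuedField.diag_apply, h2]
    exact hm ⟨x, h⟩
  let 𝒱 : PointedCover X := ⟨fun x => 𝒰.nhd x ⊓
    complOpen hη (finite_badPoints (S.diag (f x))) (generic_notMem_badPoints _),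
    fun x => Opens.mem_inf.2 ⟨𝒰.mem x, (mem_complOpen hη _ _).2 (hx x)⟩⟩
  have hf : ∀ x (p : {x : X // x ≠ η}), p.1 ∈ 𝒱.nhd x → f x ∈ S.poles p (D p) := fun x p hp =>
    coe_notMem_badPoints.1 ((mem_complOpen hη _ _).1 (Opens.mem_inf.1 hp).2)
  refine ⟨𝒱, fun x => inf_le_left, fun x => M.lift (hη.mem_nhd 𝒱 x) (f x) (hf x), ?_⟩
  · ext x y
    refine M.injective _ (hη.mem_nhd_inf 𝒱 x y) ?_
    change M.val _ _ (res F _ _ - res F _ _) = M.val _ _ (res F _ _)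
    rw [map_sub, val_res, val_res, val_res]
    erw [val_lift, val_lift]
    have := M.cochainVal_cocycle hη c η x y
    change (_ - k) - (_ - k) = M.cochainVal hη c.1 x y
    rw [this]
    ring

-- Let `B` be the finite set where `r` exceeds `D`, and let `f x` be `r x` on `B` and `0` elsewhere.
-- Let `U_x` omit the points other than `x` that lie in `B` or at which `f x` exceeds `D`. Then `c x
-- y = f y - f x` is a cocycle with repartition `f`, and `f - r` is bounded by `D`.
open Classical in
lemma toAdelic_surjective : Function.Surjective (M.toAdelic hη) := by
  intro q
  obtain ⟨r, rfl⟩ := Submodule.Quotient.mk_surjective _ q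
  let B : Set X := badPoints D r
  have hB : B.Finite := finite_badPoints r
  have hηB : η ∉ B := generic_notMem_badPoints r
  let f : X → K := fun x => if h : x ∈ B then r.1 ⟨x, h.1⟩ else 0
  let bad : X → Set X := fun x => (B ∪ badPoints D (S.diag (f x))) \ {x}
  have hbad : ∀ x, (bad x).Finite := fun x =>
    (hB.union (finite_badPoints (S.diag (f x)))).subset Set.sdiff_subset
  have hbad' : ∀ x, η ∉ bad x := fun x h =>
    h.1.elim hηB (generic_notMem_badPoints _)
  let 𝒰 : PointedCover X := ⟨fun x => complOpen hη (hbad x) (hbad' x),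
    fun x => (mem_complOpen hη _ _).2 fun h => h.2 rfl⟩
  have hgood : ∀ x (p : {x : X // x ≠ η}), p.1 ∈ 𝒰.nhd x → p.1 ≠ x →
      p.1 ∉ B ∧ f x ∈ S.poles p (D p) := by
    intro x p hp hpx
    replace hp := (mem_complOpen hη (hbad x) (hbad' x)).1 hp
    refine ⟨fun h => hp ⟨Or.inl h, hpx⟩, ?_⟩
    exact coe_notMem_badPoints.1 fun h => hp ⟨Or.inr h, hpx⟩
  have hfB : ∀ x ∉ B, f x = 0 := fun x hx => dif_neg hx
  have hpoles : ∀ x y (p : {x : X // x ≠ η}), p.1 ∈ 𝒰.nhd x ⊓ 𝒰.nhd y →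
      f y - f x ∈ S.poles p (D p) := by
    intro x y p hp
    -- If `p` equals only one of `x` and `y`, then membership of `p` in the other neighbourhood
    -- shows `p ∉ B`, so `f p = 0`.
    obtain ⟨hpx, hpy⟩ := Opens.mem_inf.1 hp
    by_cases h : p.1 = x
    · by_cases h' : p.1 = y
      · rw [← h, ← h', sub_self]
        exact Submodule.zero_mem _
      · obtain ⟨h1, h2⟩ := hgood y p hpy h'
        rw [hfB x (h ▸ h1), sub_zero]
        exact h2
    · obtain ⟨h1, h2⟩ := hgood x p hpx h
      by_cases h' : p.1 = y
      · rw [hfB y (h' ▸ h1), zero_sub]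
        exact Submodule.neg_mem _ h2
      · exact Submodule.sub_mem _ (hgood y p hpy h').2 h2
  let c : ∀ x y, F.obj (.op (𝒰.nhd x ⊓ 𝒰.nhd y)) := fun x y =>
    M.lift (hη.mem_nhd_inf 𝒰 x y) (f y - f x) (hpoles x y)
  have hc : c ∈ cocycles F 𝒰 := by
    intro x y z V hx hy hz
    have hT : η ∈ 𝒰.nhd x ⊓ (𝒰.nhd y ⊓ 𝒰.nhd z) :=
      Opens.mem_inf.2 ⟨hη.mem_nhd 𝒰 x, hη.mem_nhd_inf 𝒰 y z⟩
    -- An arbitrary `V` may miss the generic point, where no values are available. The relation is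
    -- checked on the triple intersection and then restricted.
    have key : res F (le_inf inf_le_left (inf_le_right.trans inf_le_right)) (c x z) =
        res F (le_inf inf_le_left (inf_le_right.trans inf_le_left)) (c x y) +
          res F (inf_le_right : 𝒰.nhd x ⊓ (𝒰.nhd y ⊓ 𝒰.nhd z) ≤ _) (c y z) := by
      refine M.injective _ hT ?_
      rw [map_add, val_res, val_res, val_res, val_lift, val_lift, val_lift]
      ring
    simpa using congr(res F (le_inf hx (le_inf hy hz)) $key)
  refine ⟨H1.mk F 𝒰 ⟨c, hc⟩, ?_⟩
  rw [toAdelic_mk, Submodule.Quotient.eq]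
  refine Submodule.mem_sup_left fun p => ?_
  have hp : (M.repartition hη 𝒰 ⟨c, hc⟩).1 p = f p.1 := by
    change M.val _ _ (M.lift _ _ (hpoles η p.1)) = _
    rw [val_lift, hfB η hηB, sub_zero]
  change (M.repartition hη 𝒰 ⟨c, hc⟩).1 p - r.1 p ∈ _
  rw [hp]
  by_cases h : p.1 ∈ B
  · simp [f, h]
  · rw [hfB _ h, zero_sub]
    refine Submodule.neg_mem _ ?_
    exact coe_notMem_badPoints.1 h

/-- Čech cohomology is adelic cohomology. -/
def equivAdelic : H1 F ≃ₗ[ℂ] S.AdelicH1 D :=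
  LinearEquiv.ofBijective (M.toAdelic hη) ⟨M.toAdelic_injective hη, M.toAdelic_surjective hη⟩

/-- A morphism acting on values as multiplication by `f` acts on cohomology as multiplication
by `f`. -/
lemma equivAdelic_map {G : CPresheaf X} {E : {x : X // x ≠ η} →₀ ℤ} {A : {x : X // x ≠ η} → ℤ}
    (N : SectionModel S G E) (hE : D + A = E) (α : F ⟶ G) (f : S.L A)
    (hα : ∀ U (hU : η ∈ U) (s : F.obj (.op U)),
      N.val U hU ((α.app (.op U)).hom s) = f.1 * M.val U hU s) (b : H1 F) :
    N.equivAdelic hη (H1.map α b) = S.mulH1 hE f (M.equivAdelic hη b) := by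
  obtain ⟨𝒰, c, rfl⟩ := H1.exists_mk b
  change N.toAdelic hη _ = S.mulH1 hE f (M.toAdelic hη _)
  rw [H1.map_mk, toAdelic_mk, toAdelic_mk, ValuedField.mulH1_mk]
  congr 1
  ext p
  exact hα _ _ _

end SectionModel

end CechComparison

/-! ### Smooth one-dimensional algebras are Dedekind domains -/

section SmoothAlgebra

variable (A : Type) [CommRing A] [Algebra ℂ A]

/-- The values of functions at a complex point. -/
lemma exists_sub_algebraMap_mem [Algebra.FiniteType ℂ A] (m : Ideal A) [m.IsMaximal] (a : A) :
    ∃ c : ℂ, a - algebraMap ℂ A c ∈ m := by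
  let : Field (A ⧸ m) := Ideal.Quotient.field m
  have : Algebra.FiniteType ℂ (A ⧸ m) :=
    .of_surjective (Ideal.Quotient.mkₐ ℂ m) (Ideal.Quotient.mkₐ_surjective ℂ m)
  have : Module.Finite ℂ (A ⧸ m) := finite_of_finite_type_of_isJacobsonRing ℂ (A ⧸ m)
  obtain ⟨c, hc⟩ := (IsAlgClosed.algebraMap_bijective_of_isIntegral (k := ℂ) (K := A ⧸ m)).2
    (Ideal.Quotient.mk m a)
  exact ⟨c, Ideal.Quotient.eq.1 hc.symm⟩

variable {A} in
lemma algebraMap_eq_zero_of_mem {m : Ideal A} (hm : m ≠ ⊤) {c : ℂ} (h : algebraMap ℂ A c ∈ m) :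
    c = 0 := by
  by_contra hc
  exact hm (Ideal.eq_top_of_isUnit_mem _ h ((isUnit_iff_ne_zero.2 hc).map (algebraMap ℂ A)))

/-- If all differentials on `A` are multiples of one of them, then so are all elements of the
cotangent space at a complex point. -/
lemma exists_le_span_sup_sq [Algebra.FiniteType ℂ A] (ω : Ω[A⁄ℂ])
    (hω : ∀ x : Ω[A⁄ℂ], ∃ a : A, a • ω = x) (m : Ideal A) [hm : m.IsMaximal] :
    ∃ t ∈ m, m ≤ Ideal.span {t} ⊔ m ^ 2 := by
  choose c hc using exists_sub_algebraMap_mem A m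
  have huniq : ∀ a b : A, a - b ∈ m → c a = c b := by
    intro a b hab
    rw [← sub_eq_zero]
    refine algebraMap_eq_zero_of_mem hm.ne_top ?_
    have := m.sub_mem (m.add_mem hab (hc b)) (hc a)
    rw [map_sub]
    convert this using 1
    ring
  have hcadd : ∀ a b, c (a + b) = c a + c b := by
    intro a b
    rw [← sub_eq_zero]
    refine algebraMap_eq_zero_of_mem hm.ne_top ?_
    have := m.sub_mem (m.add_mem (hc a) (hc b)) (hc (a + b))
    rw [map_sub, map_add]
    convert this using 1
    ring
  have hcmul : ∀ a b, c (a * b) = c a * c b := by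
    intro a b
    rw [← sub_eq_zero]
    refine algebraMap_eq_zero_of_mem hm.ne_top ?_
    have := m.sub_mem (m.add_mem (m.mul_mem_right b (hc a))
      (m.mul_mem_left (algebraMap ℂ A (c a)) (hc b))) (hc (a * b))
    rw [map_sub, map_mul]
    convert this using 1
    ring
  have hcalg : ∀ r : ℂ, c (algebraMap ℂ A r) = r := by
    intro r
    rw [← sub_eq_zero]
    refine algebraMap_eq_zero_of_mem hm.ne_top ?_
    have := m.neg_mem (hc (algebraMap ℂ A r))
    rw [map_sub]
    convert this using 1
    ring
  -- The map `a ↦ a - a(m)` into `m / m²` is a derivation, where `a(m) = c a` is the value of `a`.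
  -- It factors through the differentials and is onto, so the image of `ω` generates the cotangent
  -- space.
  let δ : Derivation ℂ A m.Cotangent := Derivation.mk'
    { toFun := fun a => m.toCotangent ⟨_, hc a⟩
      map_add' := fun a b => by
        rw [← map_add]
        congr 1
        ext
        simp only [hcadd, map_add, Submodule.coe_add]
        ring
      map_smul' := fun r a => by
        rw [RingHom.id_apply, ← algebraMap_smul A r (m.toCotangent _), ← map_smul]
        congr 1
        ext
        simp only [Algebra.smul_def, hcmul, hcalg, map_mul, Submodule.coe_smul,
          Algebra.algebraMap_self, RingHom.id_apply]
        ring }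
    (fun a b => by
      change m.toCotangent _ = a • m.toCotangent _ + b • m.toCotangent _
      -- The defect in the Leibniz rule is `-(a - a(m)) (b - b(m)) ∈ m²`.
      rw [← map_smul, ← map_smul, ← map_add, Ideal.toCotangent_eq, pow_two]
      have := Ideal.mul_mem_mul (m.neg_mem (hc a)) (hc b)
      convert this using 1
      simp only [hcmul, map_mul, Submodule.coe_add, Submodule.coe_smul, smul_eq_mul]
      ring)
  obtain ⟨⟨t, ht⟩, hδω⟩ := m.toCotangent_surjective (δ.liftKaehlerDifferential ω)
  refine ⟨t, ht, fun a ha => ?_⟩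
  obtain ⟨b, hb⟩ := hω (KaehlerDifferential.D ℂ A a)
  have h1 := congr(δ.liftKaehlerDifferential $hb)
  rw [map_smul, Derivation.liftKaehlerDifferential_comp_D, ← hδω, ← map_smul] at h1
  change _ = m.toCotangent _ at h1
  rw [Ideal.toCotangent_eq] at h1
  have hca : c a = 0 := by
    have := huniq a 0 (by simpa using ha)
    rw [this, ← map_zero (algebraMap ℂ A), hcalg]
  simp only [hca, map_zero, sub_zero, Submodule.coe_smul, smul_eq_mul] at h1
  rw [← sub_sub_cancel (b * t) a]
  exact Ideal.sub_mem _ (Ideal.mem_sup_left (Ideal.mul_mem_left _ _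
    (Ideal.mem_span_singleton_self t))) (Ideal.mem_sup_right h1)

/-- The values of germs at a complex point. -/
lemma exists_sub_algebraMap_mem_maximalIdeal [Algebra.FiniteType ℂ A] (m : Ideal A) [m.IsMaximal]
    (R : Type) [CommRing R] [IsLocalRing R] [Algebra A R] [IsLocalization.AtPrime R m] (r : R) :
    ∃ c : ℂ, r - algebraMap A R (algebraMap ℂ A c) ∈ IsLocalRing.maximalIdeal R := by
  obtain ⟨a, s, rfl⟩ := IsLocalization.exists_mk'_eq m.primeCompl r
  obtain ⟨c, hc⟩ := exists_sub_algebraMap_mem A m a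
  obtain ⟨d, hd⟩ := exists_sub_algebraMap_mem A m s.1
  have hd0 : d ≠ 0 := by
    rintro rfl
    exact s.2 (by simpa using hd)
  refine ⟨c / d, ?_⟩
  have hu := IsLocalization.map_units R s
  rw [← Ideal.mul_unit_mem_iff_mem _ hu, sub_mul, IsLocalization.mk'_spec, ← map_mul, ← map_sub,
    ← IsLocalization.AtPrime.map_eq_maximalIdeal m R]
  refine Ideal.mem_map_of_mem _ ?_
  have := m.sub_mem hc (m.mul_mem_left (algebraMap ℂ A (c / d)) hd)
  convert this using 1
  rw [mul_sub, ← map_mul, div_mul_cancel₀ c hd0]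
  ring

variable [Algebra.IsStandardSmoothOfRelativeDimension 1 ℂ A]

lemma finitePresentation_of_isStandardSmoothOfRelativeDimension_one :
    Algebra.FinitePresentation ℂ A :=
  have := Algebra.IsStandardSmoothOfRelativeDimension.isStandardSmooth (R := ℂ) (S := A) 1
  inferInstance

variable [IsDomain A]

/-- The differentials are free of rank one, so `m / m²` is generated by one element, and Nakayama
makes the maximal ideal of the localization principal. It is nonzero: `m = 0` would give `A = ℂ`,
which has no differentials. -/
lemma isDiscreteValuationRing_localization_of_isMaximal (m : Ideal A) [m.IsMaximal] :
    IsDiscreteValuationRing (Localization.AtPrime m) := by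
  have := finitePresentation_of_isStandardSmoothOfRelativeDimension_one A
  have : IsNoetherianRing A := Algebra.FiniteType.isNoetherianRing ℂ A
  have := Algebra.IsStandardSmoothOfRelativeDimension.isStandardSmooth (R := ℂ) (S := A) 1
  have hrank := Algebra.IsStandardSmoothOfRelativeDimension.rank_kaehlerDifferential
    (R := ℂ) (S := A) 1
  have hfr : Module.finrank A Ω[A⁄ℂ] = 1 := by
    simp [Module.finrank, hrank]
  let B := Module.basisUnique Unit hfr
  obtain ⟨t, ht, hmt⟩ := exists_le_span_sup_sq A (B ())
    (fun x => ⟨B.repr x (), by simpa using B.sum_repr x⟩) m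
  have hbot : m ≠ ⊥ := by
    rintro rfl
    have hsurj : Function.Surjective (algebraMap ℂ A) := fun a => by
      obtain ⟨c, hc⟩ := exists_sub_algebraMap_mem A ⊥ a
      exact ⟨c, (sub_eq_zero.1 hc).symm⟩
    have := KaehlerDifferential.subsingleton_of_surjective ℂ A hsurj
    rw [Module.finrank_zero_of_subsingleton] at hfr
    exact zero_ne_one hfr
  have hfield : ¬ IsField (Localization.AtPrime m) := by
    rw [IsLocalRing.isField_iff_maximalIdeal_eq, ← Localization.AtPrime.map_eq_maximalIdeal]
    intro h
    rw [Ideal.map_eq_bot_iff_of_injective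
      (IsLocalization.injective _ m.primeCompl_le_nonZeroDivisors)] at h
    exact hbot h
  refine ((IsDiscreteValuationRing.TFAE _ hfield).out 4 0).1 ?_
  refine ⟨⟨algebraMap _ _ t, le_antisymm ?_ ?_⟩⟩
  · refine Submodule.le_of_le_smul_of_le_jacobson_bot
      (I := IsLocalRing.maximalIdeal (Localization.AtPrime m)) (IsNoetherian.noetherian _)
      (IsLocalRing.maximalIdeal_le_jacobson _) ?_
    have := Ideal.map_mono (f := algebraMap A (Localization.AtPrime m)) hmt
    rw [Ideal.map_sup, Ideal.map_span, Set.image_singleton, Ideal.map_pow,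
      Localization.AtPrime.map_eq_maximalIdeal, pow_two] at this
    exact this
  · rw [← Ideal.span, Ideal.span_singleton_le_iff_mem, ← Localization.AtPrime.map_eq_maximalIdeal]
    exact Ideal.mem_map_of_mem _ ht

/-- A nonzero prime inside a maximal ideal `m` stays a nonzero prime in the discrete valuation ring
at `m`. There it must be the maximal ideal, so the prime is `m`. -/
lemma isDedekindDomain_of_isStandardSmoothOfRelativeDimension_one : IsDedekindDomain A := by
  have := finitePresentation_of_isStandardSmoothOfRelativeDimension_one A
  have : IsNoetherianRing A := Algebra.FiniteType.isNoetherianRing ℂ A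
  have hmax : ∀ P : Ideal A, P ≠ ⊥ → P.IsPrime → P.IsMaximal := by
    intro P hP hP'
    obtain ⟨m, hm, hle⟩ := P.exists_le_maximal hP'.ne_top
    have := isDiscreteValuationRing_localization_of_isMaximal A m
    have hdisj : Disjoint (m.primeCompl : Set A) P :=
      Set.disjoint_left.2 fun x hx hx' => hx (hle hx')
    have h1 := IsLocalization.isPrime_of_isPrime_disjoint m.primeCompl
      (Localization.AtPrime m) P hP' hdisj
    have h2 : P.map (algebraMap A (Localization.AtPrime m)) ≠ ⊥ := fun h =>
      hP ((Ideal.map_eq_bot_iff_of_injective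
        (IsLocalization.injective _ m.primeCompl_le_nonZeroDivisors)).1 h)
    have h3 := IsLocalRing.eq_maximalIdeal (h1.isMaximal h2)
    have h4 := IsLocalization.under_map_of_isPrime_disjoint m.primeCompl
      (Localization.AtPrime m) hP' hdisj
    rw [h3, Localization.AtPrime.under_maximalIdeal] at h4
    rwa [← h4]
  have : IsDedekindDomainDvr A :=
    ⟨fun P hP hP' => have := hmax P hP hP'; isDiscreteValuationRing_localization_of_isMaximal A P⟩
  infer_instance

end SmoothAlgebra

/-! ### Points, local rings and valuations of a smooth projective curve -/

section CurveGeometry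

variable {C : Scheme.{0}} [C.Over SpecC]

variable [IsSmoothProjectiveCurve C]

instance : LocallyOfFiniteType (C ↘ SpecC) :=
  have := IsSmoothProjectiveCurve.isProper (C := C)
  inferInstance

instance : CompactSpace C :=
  have := IsSmoothProjectiveCurve.isProper (C := C)
  QuasiCompact.compactSpace_of_compactSpace (C ↘ SpecC)

instance : NoetherianSpace C :=
  have : AlgebraicGeometry.IsNoetherian C := { }
  inferInstance

/-- A smooth curve is covered by spectra of standard smooth algebras. -/
lemma exists_chart (x : C) : ∃ (V : C.Opens) (_ : IsAffineOpen V), x ∈ V ∧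
    Algebra.IsStandardSmoothOfRelativeDimension 1 ℂ Γ(C, V) := by
  obtain ⟨U, hU, V, hV, hx, e, h⟩ :=
    (IsSmoothProjectiveCurve.smooth (C := C)).exists_isStandardSmoothOfRelativeDimension x
  -- The base has a single point, so an open set containing an image point is everything.
  have hUtop : U = ⊤ := by
    refine top_le_iff.1 fun y _ => ?_
    rw [Subsingleton.elim y ((C ↘ SpecC) x)]
    exact e hx
  subst hUtop
  refine ⟨V, hV, hx, ?_⟩
  have := h.comp (RingHom.IsStandardSmoothOfRelativeDimension.equiv
    (Scheme.ΓSpecIso (.of ℂ)).symm.commRingCatIsoToRingEquiv)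
  exact this

lemma primeIdealOf_ne_bot {V : C.Opens} (hV : IsAffineOpen V) (x : V)
    (hx : x.1 ≠ genericPoint C) : (hV.primeIdealOf x).asIdeal ≠ ⊥ := by
  intro h
  have : Nonempty V := ⟨x⟩
  apply hx
  rw [← hV.fromSpec_primeIdealOf x, ← genericPoint_eq_of_isOpenImmersion hV.fromSpec,
    genericPoint_eq_bot_of_affine]
  congr 1
  exact PrimeSpectrum.ext h

/-- If `y` lies in the closure of `x`, a chart around `y` contains `x`. The chart ring is Dedekind,
so the nonzero prime of `x` is maximal. Being contained in the prime of `y`, it equals it. -/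
lemma isClosed_singleton_of_ne_genericPoint {x : C} (hx : x ≠ genericPoint C) :
    IsClosed {x} := by
  refine closure_subset_iff_isClosed.1 fun y hy => ?_
  have hxy : x ⤳ y := specializes_iff_mem_closure.2 hy
  obtain ⟨V, hV, hyV, h⟩ := exists_chart y
  have hxV : x ∈ V := hxy.mem_open V.isOpen hyV
  have : Nonempty V := ⟨⟨y, hyV⟩⟩
  have := isDedekindDomain_of_isStandardSmoothOfRelativeDimension_one Γ(C, V)
  have h1 : hV.primeIdealOf ⟨x, hxV⟩ ⤳ hV.primeIdealOf ⟨y, hyV⟩ := by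
    refine hV.fromSpec.isOpenEmbedding.isInducing.specializes_iff.1 ?_
    rw [hV.fromSpec_primeIdealOf, hV.fromSpec_primeIdealOf]
    exact hxy
  have h2 := (PrimeSpectrum.le_iff_specializes _ _).2 h1
  have h3 : (hV.primeIdealOf ⟨x, hxV⟩).asIdeal = (hV.primeIdealOf ⟨y, hyV⟩).asIdeal :=
    ((hV.primeIdealOf ⟨x, hxV⟩).isPrime.isMaximal (primeIdealOf_ne_bot hV ⟨x, hxV⟩ hx)).eq_of_le
      (hV.primeIdealOf ⟨y, hyV⟩).isPrime.ne_top h2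
  have h4 := congr(hV.fromSpec $(PrimeSpectrum.ext h3))
  rw [hV.fromSpec_primeIdealOf, hV.fromSpec_primeIdealOf] at h4
  exact h4.symm

lemma isDiscreteValuationRing_stalk {x : C} (hx : x ≠ genericPoint C) :
    IsDiscreteValuationRing (C.presheaf.stalk x) := by
  obtain ⟨V, hV, hxV, h⟩ := exists_chart x
  have : Nonempty V := ⟨⟨x, hxV⟩⟩
  have := isDedekindDomain_of_isStandardSmoothOfRelativeDimension_one Γ(C, V)
  let := TopCat.Presheaf.algebra_section_stalk C.presheaf ⟨x, hxV⟩
  have := hV.isLocalization_stalk ⟨x, hxV⟩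
  exact IsLocalization.AtPrime.isDiscreteValuationRing_of_dedekind_domain Γ(C, V)
    (primeIdealOf_ne_bot hV ⟨x, hxV⟩ hx) _

/-- `Scheme.ord` is the order of vanishing only at points of coheight one. -/
lemma coheight_eq_one {x : C} (hx : x ≠ genericPoint C) : Order.coheight x = 1 := by
  have := isDiscreteValuationRing_stalk hx
  have h := ringKrullDim_stalk_eq_coheight x
  rw [IsDiscreteValuationRing.ringKrullDim_eq_one] at h
  exact_mod_cast h.symm

/-- A closed set in a noetherian space has finitely many irreducible components. Away from the
generic point, each is the closure of a closed point. -/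
lemma isCurveGenericPoint_genericPoint :
    IsCurveGenericPoint (X := C.toTopCat) (genericPoint C) where
  specializes x := genericPoint_specializes (show C from x)
  isClosed_iff s hs := by
    have : NoetherianSpace C.toTopCat := inferInstanceAs (NoetherianSpace C)
    have : QuasiSober C.toTopCat := inferInstanceAs (QuasiSober C)
    constructor
    · intro hs'
      obtain ⟨S, hS, hSc, hSi, rfl⟩ := NoetherianSpace.exists_finite_set_isClosed_irreducible hs'
      refine hS.sUnion fun t ht => ?_
      obtain ⟨z, hz⟩ := QuasiSober.sober (hSi t ht) (hSc t ht)
      have hzt : z ∈ t := hz.mem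
      have hzη : z ≠ genericPoint C := by
        rintro rfl
        exact hs (Set.mem_sUnion_of_mem hzt ht)
      rw [← hz.def, (isClosed_singleton_of_ne_genericPoint hzη).closure_eq]
      exact Set.finite_singleton z
    · intro hs'
      rw [← Set.biUnion_of_singleton s]
      refine hs'.isClosed_biUnion fun x hx => isClosed_singleton_of_ne_genericPoint ?_
      rintro rfl
      exact hs hx

lemma exists_residue {x : C} (hx : x ≠ genericPoint C) (r : C.presheaf.stalk x) :
    ∃ c : ℂ, r - C.presheaf.germ ⊤ x trivial (constants ⊤ c) ∈
      IsLocalRing.maximalIdeal (C.presheaf.stalk x) := by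
  obtain ⟨V, hV, hxV, h⟩ := exists_chart x
  let := TopCat.Presheaf.algebra_section_stalk C.presheaf ⟨x, hxV⟩
  have := hV.isLocalization_stalk ⟨x, hxV⟩
  have := hV.primeIdealOf_isMaximal_of_isClosed ⟨x, hxV⟩ (isClosed_singleton_of_ne_genericPoint hx)
  have := finitePresentation_of_isStandardSmoothOfRelativeDimension_one Γ(C, V)
  obtain ⟨c, hc⟩ := exists_sub_algebraMap_mem_maximalIdeal Γ(C, V)
    (hV.primeIdealOf ⟨x, hxV⟩).asIdeal (C.presheaf.stalk x) r
  refine ⟨c, ?_⟩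
  convert hc using 2
  change _ = C.presheaf.germ V x hxV (constants V c)
  rw [← fres_constants (le_top : V ≤ ⊤)]
  exact (C.presheaf.germ_res_apply (homOfLE le_top) x hxV _).symm

variable (C) in
instance nonempty_top : Nonempty (⊤ : C.Opens) := ⟨⟨genericPoint C, trivial⟩⟩

variable (C) in
/-- The function field is an algebra over `ℂ`. -/
instance : Algebra ℂ C.functionField :=
  ((C.germToFunctionField ⊤).hom.comp (constants ⊤)).toAlgebra

lemma algebraMap_functionField (c : ℂ) :
    algebraMap ℂ C.functionField c = C.germToFunctionField ⊤ (constants ⊤ c) := rfl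

lemma ord_nonneg_iff {x : C} (hx : x ≠ genericPoint C) {f : C.functionField} (hf : f ≠ 0) :
    0 ≤ Scheme.ord f x ↔ ∃ r : C.presheaf.stalk x, algebraMap _ _ r = f := by
  have := isDiscreteValuationRing_stalk hx
  rw [Scheme.le_ord_iff (coheight_eq_one hx) hf]
  change 1 ≤ Ring.ordFrac (C.presheaf.stalk x) f ↔ _
  rw [Ring.ordFrac_eq_valuation_inv, one_le_inv₀ (by simpa [zero_lt_iff] using hf)]
  constructor
  · exact IsDiscreteValuationRing.exists_lift_of_le_one
  · rintro ⟨r, rfl⟩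
    exact IsDedekindDomain.HeightOneSpectrum.valuation_le_one _ r

lemma ord_pos_of_mem_maximalIdeal {x : C} (hx : x ≠ genericPoint C) {r : C.presheaf.stalk x}
    (hr : r ∈ IsLocalRing.maximalIdeal (C.presheaf.stalk x)) (hr0 : r ≠ 0) :
    0 < Scheme.ord (algebraMap (C.presheaf.stalk x) C.functionField r) x := by
  have := isDiscreteValuationRing_stalk hx
  have hf : algebraMap (C.presheaf.stalk x) C.functionField r ≠ 0 := by simpa using hr0
  refine lt_of_le_of_ne ((ord_nonneg_iff hx hf).2 ⟨r, rfl⟩) fun h => ?_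
  have h' := (Scheme.ord_eq_iff (coheight_eq_one hx) hf).1 h.symm
  change Ring.ordFrac (C.presheaf.stalk x) _ = 1 at h'
  rw [← Ring.isUnit_iff_ordFrac_one_of_isDiscreteValuationRing] at h'
  exact hr h'

lemma exists_ord_eq_one {x : C} (hx : x ≠ genericPoint C) :
    ∃ t : C.functionField, t ≠ 0 ∧ Scheme.ord t x = 1 := by
  have := isDiscreteValuationRing_stalk hx
  obtain ⟨t, ht⟩ := IsDiscreteValuationRing.exists_irreducible (C.presheaf.stalk x)
  have hf : algebraMap (C.presheaf.stalk x) C.functionField t ≠ 0 := by simpa using ht.ne_zero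
  exact ⟨_, hf, (Scheme.ord_eq_iff (coheight_eq_one hx) hf).2 (Ring.ordFrac_irreducible ht)⟩

variable (C) in
/-- The function field of a smooth projective curve with the valuations at its closed points. -/
def functionFieldValuations : ValuedField {x : C.toTopCat // x ≠ genericPoint C} C.functionField where
  ord p f := Scheme.ord f p.1
  ord_mul p f g hf hg := Scheme.ord_mul hf hg
  min_le_ord_add p f g _ _ hfg :=
    have := isDiscreteValuationRing_stalk p.2
    Scheme.ord_add hfg
  ord_algebraMap p c hc := by
    rw [algebraMap_functionField]
    exact Scheme.ord_of_isUnit ((isUnit_iff_ne_zero.2 hc).map (constants ⊤)) (Opens.mem_top p.1)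
  exists_ord_eq_one p := exists_ord_eq_one p.2
  exists_residue p f hf h := by
    obtain ⟨r, rfl⟩ := (ord_nonneg_iff p.2 hf).1 h.ge
    obtain ⟨c, hc⟩ := exists_residue p.2 r
    refine ⟨c, ?_⟩
    rw [algebraMap_functionField, ← Scheme.algebraMap_germ_eq_germToFunctionField C
      (U := (⊤ : C.Opens)) (x := p.1) trivial, ← map_sub]
    by_cases h0 : r - C.presheaf.germ ⊤ p.1 trivial (constants ⊤ c) = 0
    · exact Or.inl congr(algebraMap _ _ $(sub_eq_zero.1 h0))
    · exact Or.inr (ord_pos_of_mem_maximalIdeal p.2 hc h0)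
  finite_support f hf := by
    obtain ⟨U, -, g, hU, rfl, hg⟩ := exists_isUnit_germ_eq C f hf
    have hη : genericPoint C ∈ U :=
      ((genericPoint_spec C).mem_open_set_iff U.isOpen).2 (by simpa using hU)
    have hfin : ((U : Set C)ᶜ).Finite :=
      (isCurveGenericPoint_genericPoint.isClosed_iff _ (Set.notMem_compl_iff.2 hη)).1
        U.isOpen.isClosed_compl
    refine (hfin.preimage (f := Subtype.val) Subtype.val_injective.injOn).subset fun p hp => ?_
    refine Set.mem_preimage.2 (Set.mem_compl fun hpU => hp (Scheme.ord_of_isUnit hg hpU))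

end CurveGeometry

/-! ### Gluing sections of sheaves of modules -/

section Gluing

variable {C : Scheme.{0}} (M : C.Modules)

lemma mres_eq_zero_of_locally {U : C.Opens} (t : Γ(M, U))
    (h : ∀ x ∈ U, ∃ (V : C.Opens) (hV : V ≤ U), x ∈ V ∧ mres M hV t = 0) : t = 0 := by
  choose V hV hxV ht using fun x : U => h x.1 x.2
  refine TopCat.Sheaf.eq_of_locally_eq' ⟨M.presheaf, M.isSheaf⟩ V U (fun x => homOfLE (hV x))
    (fun x hx => Opens.mem_iSup.2 ⟨⟨x, hx⟩, hxV _⟩) t 0 fun x => ?_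
  rw [map_zero]
  exact ht x

lemma exists_glue {U : C.Opens} (V : U → C.Opens) (hV : ∀ x, V x ≤ U) (hx : ∀ x : U, x.1 ∈ V x)
    (t : ∀ x, Γ(M, V x))
    (h : ∀ x y, mres M inf_le_left (t x) = mres M (inf_le_right : V x ⊓ V y ≤ V y) (t y)) :
    ∃ s : Γ(M, U), ∀ x, mres M (hV x) s = t x :=
  (TopCat.Sheaf.existsUnique_gluing' ⟨M.presheaf, M.isSheaf⟩ V U (fun x => homOfLE (hV x))
    (fun x hxU => Opens.mem_iSup.2 ⟨⟨x, hxU⟩, hx _⟩) t h).exists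

end Gluing

/-! ### Coordinates of sections in the function field -/

section FunctionField

variable {C : Scheme.{0}}

variable [IsIntegral C]

/-- The rational function defined by a regular function on a neighbourhood of the generic point. -/
def gval (U : C.Opens) (hU : genericPoint C ∈ U) : Γ(C, U) →+* C.functionField :=
  (C.presheaf.germ U (genericPoint C) hU).hom

@[simp] lemma gval_fres {U V : C.Opens} (h : V ≤ U) (hV : genericPoint C ∈ V) (f : Γ(C, U)) :
    gval V hV (fres h f) = gval U (h hV) f :=
  C.presheaf.germ_res_apply (homOfLE h) _ hV f

lemma gval_injective (U : C.Opens) (hU : genericPoint C ∈ U) : Function.Injective (gval U hU) :=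
  germ_injective_of_isIntegral C _ hU

lemma germToFunctionField_eq_gval (U : C.Opens) (hU : genericPoint C ∈ U) [Nonempty U]
    (f : Γ(C, U)) : C.germToFunctionField U f = gval U hU f := rfl

lemma algebraMap_germ {U : C.Opens} {x : C} (hx : x ∈ U) (hU : genericPoint C ∈ U) (f : Γ(C, U)) :
    algebraMap (C.presheaf.stalk x) C.functionField (C.presheaf.germ U x hx f) = gval U hU f :=
  have : Nonempty U := ⟨⟨x, hx⟩⟩
  Scheme.algebraMap_germ_eq_germToFunctionField C hx f

lemma genericPoint_mem {U : C.Opens} {x : C} (hx : x ∈ U) : genericPoint C ∈ U :=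
  (genericPoint_specializes x).mem_open U.isOpen hx

lemma genericPoint_mem_inf {U V : C.Opens} (hU : genericPoint C ∈ U) (hV : genericPoint C ∈ V) :
    genericPoint C ∈ U ⊓ V :=
  Opens.mem_inf.2 ⟨hU, hV⟩

lemma exists_gval_eq_algebraMap {U : C.Opens} {x : C} (hx : x ∈ U) (r : C.presheaf.stalk x) :
    ∃ (W : C.Opens) (_ : W ≤ U) (hxW : x ∈ W) (g : Γ(C, W)),
      gval W (genericPoint_mem hxW) g = algebraMap _ _ r := by
  obtain ⟨W, hW, g, rfl⟩ := C.presheaf.exists_germ_eq r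
  refine ⟨W ⊓ U, inf_le_right, Opens.mem_inf.2 ⟨hW, hx⟩, fres inf_le_left g, ?_⟩
  rw [gval_fres, algebraMap_germ hW]

lemma exists_gval_eq {U : C.Opens} (hU : genericPoint C ∈ U) (k : C.functionField) :
    ∃ (W : C.Opens) (_ : W ≤ U) (hW : genericPoint C ∈ W) (g : Γ(C, W)), gval W hW g = k := by
  obtain ⟨W, hW, g, rfl⟩ := C.presheaf.exists_germ_eq k
  exact ⟨W ⊓ U, inf_le_right, Opens.mem_inf.2 ⟨hW, hU⟩, fres inf_le_left g, gval_fres _ _ _⟩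

/-- A trivialisation of a sheaf of modules at the generic point. -/
structure GenericFrame (M : C.Modules) where
  U : C.Opens
  mem : genericPoint C ∈ U
  e : Γ(M, U)
  isFrame : IsFrame M U e

namespace GenericFrame

variable {M : C.Modules} (F : GenericFrame M)

lemma exists_coord {U : C.Opens} (t : Γ(M, U)) :
    ∃ a : Γ(C, U ⊓ F.U), a • mres M inf_le_right F.e = mres M inf_le_left t :=
  (F.isFrame _ inf_le_right).2 _

/-- The coordinate of a section with respect to a generic frame, as a rational function. -/
def coord (U : C.Opens) (hU : genericPoint C ∈ U) (t : Γ(M, U)) : C.functionField :=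
  gval (U ⊓ F.U) (genericPoint_mem_inf hU F.mem) (F.exists_coord t).choose

/-- The coordinate can be read off on any smaller neighbourhood of the generic point, which yields
its linearity and compatibility with restriction. -/
lemma coord_eq {U W : C.Opens} (hWU : W ≤ U) (hWF : W ≤ F.U) (hW : genericPoint C ∈ W)
    (t : Γ(M, U)) (a : Γ(C, W)) (h : a • mres M hWF F.e = mres M hWU t) :
    F.coord U (hWU hW) t = gval W hW a := by
  have h1 := (F.exists_coord t).choose_spec
  have h2 := congr(mres M (le_inf hWU hWF) $h1)
  rw [mres_smul, mres_mres, mres_mres, ← h] at h2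
  rw [coord, ← (F.isFrame W hWF).1 h2, gval_fres]

lemma exists_eq_coord (U : C.Opens) (hU : genericPoint C ∈ U) (t : Γ(M, U)) :
    ∃ a : Γ(C, U ⊓ F.U), a • mres M inf_le_right F.e = mres M inf_le_left t ∧
      F.coord U hU t = gval _ (genericPoint_mem_inf hU F.mem) a :=
  ⟨_, (F.exists_coord t).choose_spec, rfl⟩

lemma coord_mres {U V : C.Opens} (h : V ≤ U) (hV : genericPoint C ∈ V) (t : Γ(M, U)) :
    F.coord V hV (mres M h t) = F.coord U (h hV) t := by
  obtain ⟨a, ha, ha'⟩ := F.exists_eq_coord V hV (mres M h t)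
  rw [ha', ← F.coord_eq (inf_le_left.trans h) inf_le_right _ t a (by rw [ha, mres_mres])]

lemma coord_add (U : C.Opens) (hU : genericPoint C ∈ U) (s t : Γ(M, U)) :
    F.coord U hU (s + t) = F.coord U hU s + F.coord U hU t := by
  obtain ⟨a, ha, ha'⟩ := F.exists_eq_coord U hU s
  obtain ⟨b, hb, hb'⟩ := F.exists_eq_coord U hU t
  rw [ha', hb', ← map_add]
  exact F.coord_eq inf_le_left inf_le_right _ _ _ (by rw [add_smul, ha, hb, map_add])

lemma coord_smul (U : C.Opens) (hU : genericPoint C ∈ U) (f : Γ(C, U)) (t : Γ(M, U)) :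
    F.coord U hU (f • t) = gval U hU f * F.coord U hU t := by
  obtain ⟨a, ha, ha'⟩ := F.exists_eq_coord U hU t
  have hη := genericPoint_mem_inf hU F.mem
  rw [ha', ← gval_fres inf_le_left hη f, ← map_mul]
  exact F.coord_eq inf_le_left inf_le_right _ _ _ (by rw [mul_smul, ha, mres_smul])

/-- Near `x` write `t = b • e` with a local frame. The vanishing coordinate makes `b` vanish on the
overlap with the generic frame. On an integral scheme this forces `b = 0`. -/
lemma coord_injective (hM : IsLineBundle M) (U : C.Opens) (hU : genericPoint C ∈ U)
    (t : Γ(M, U)) (ht : F.coord U hU t = 0) : t = 0 := by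
  refine mres_eq_zero_of_locally M t fun x hx => ?_
  obtain ⟨V, e, hxV, he⟩ := hM x
  refine ⟨U ⊓ V, inf_le_left, Opens.mem_inf.2 ⟨hx, hxV⟩, ?_⟩
  obtain ⟨b, hb⟩ := (he (U ⊓ V) inf_le_right).2 (mres M inf_le_left t)
  change b • mres M inf_le_right e = mres M inf_le_left t at hb
  have hηV := genericPoint_mem hxV
  have hη : genericPoint C ∈ (U ⊓ V) ⊓ F.U :=
    genericPoint_mem_inf (genericPoint_mem_inf hU hηV) F.mem
  obtain ⟨a, ha, ha'⟩ := F.exists_eq_coord U hU t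
  rw [ha'] at ht
  have ha0 : a = 0 := gval_injective _ _ (by rw [ht, map_zero])
  rw [ha0, zero_smul] at ha
  have hTV : (U ⊓ V) ⊓ F.U ≤ V := inf_le_left.trans inf_le_right
  have h1 : fres (inf_le_left : (U ⊓ V) ⊓ F.U ≤ U ⊓ V) b • mres M hTV e =
      (0 : Γ(C, (U ⊓ V) ⊓ F.U)) • mres M hTV e := by
    have h2 := congr(mres M (inf_le_left : (U ⊓ V) ⊓ F.U ≤ U ⊓ V) $hb)
    have h3 := congr(mres M (le_inf (inf_le_left.trans inf_le_left) inf_le_right :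
      (U ⊓ V) ⊓ F.U ≤ U ⊓ F.U) $ha)
    rw [map_zero, mres_mres] at h3
    rw [mres_smul, mres_mres, mres_mres, ← h3] at h2
    rw [h2, zero_smul, h3]
  have h4 := (he _ _).1 h1
  have hb0 : b = 0 := gval_injective _ (genericPoint_mem_inf hU hηV) (by
    rw [← gval_fres inf_le_left hη, h4, map_zero, map_zero])
  rw [← hb, hb0, zero_smul]

lemma coord_inj (hM : IsLineBundle M) (U : C.Opens) (hU : genericPoint C ∈ U)
    {s t : Γ(M, U)} (h : F.coord U hU s = F.coord U hU t) : s = t := by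
  have h1 := F.coord_add U hU (s - t) t
  rw [sub_add_cancel, h, right_eq_add] at h1
  exact sub_eq_zero.1 (F.coord_injective hM U hU _ h1)

lemma coord_frame_ne_zero (hM : IsLineBundle M) {V : C.Opens} {e : Γ(M, V)} (he : IsFrame M V e)
    (hV : genericPoint C ∈ V) : F.coord V hV e ≠ 0 := by
  intro h
  have he0 := F.coord_injective hM V hV e h
  have h1 : (1 : Γ(C, V)) • mres M le_rfl e = (0 : Γ(C, V)) • mres M le_rfl e := by
    rw [he0, map_zero, smul_zero, smul_zero]
  have h2 := congr(gval V hV $((he V le_rfl).1 h1))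
  rw [map_one, map_zero] at h2
  exact one_ne_zero h2

end GenericFrame

lemma IsLineBundle.genericFrame {M : C.Modules} (hM : IsLineBundle M) :
    Nonempty (GenericFrame M) := by
  obtain ⟨U, e, hU, he⟩ := hM (genericPoint C)
  exact ⟨⟨U, hU, e, he⟩⟩

end FunctionField

/-! ### Line bundles as sheaves of rational functions with bounded poles -/

section LineBundleModel

variable {C : Scheme.{0}} [C.Over SpecC] [IsSmoothProjectiveCurve C]

lemma gval_constants (U : C.Opens) (hU : genericPoint C ∈ U) (c : ℂ) :
    gval U hU (constants U c) = algebraMap ℂ C.functionField c := by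
  rw [← fres_constants le_top c, gval_fres]
  rfl

variable {M : C.Modules} (F : GenericFrame M)

lemma coord_smul_constant (U : C.Opens) (hU : genericPoint C ∈ U) (c : ℂ) (t : Γ(M, U)) :
    F.coord U hU (c • t) = c • F.coord U hU t := by
  rw [constants_smul, F.coord_smul, gval_constants, Algebra.smul_def]

/-- The pointwise order of a nonzero rational section with respect to local frames. -/
lemma exists_frame_of_hasOrderAt (hM : IsLineBundle M) {V : C.Opens} (hV : genericPoint C ∈ V)
    {s : Γ(M, V)} (hs : s ≠ 0) {x : C} {n : ℤ} (h : HasOrderAt M s x n) :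
    ∃ (U : C.Opens) (hx : x ∈ U) (e : Γ(M, U)), IsFrame M U e ∧
      Scheme.ord (F.coord V hV s) x =
        n + Scheme.ord (F.coord U (genericPoint_mem hx) e) x := by
  obtain ⟨U, e, W, hWU, hWV, ⟨⟨w, hw⟩⟩, f, hx, he, hse, hn⟩ := h
  have hW : genericPoint C ∈ W := genericPoint_mem hw
  refine ⟨U, hx, e, he, ?_⟩
  have hs' : F.coord V hV s = gval W hW f * F.coord U (genericPoint_mem hx) e := by
    rw [← F.coord_mres hWV hW, hse, F.coord_smul, F.coord_mres]
  have hs0 : F.coord V hV s ≠ 0 := fun h => hs (F.coord_injective hM V hV s h)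
  rw [hs'] at hs0 ⊢
  obtain ⟨h1, h2⟩ := mul_ne_zero_iff.1 hs0
  rw [Scheme.ord_mul h1 h2, ← hn]
  rfl

/-- The quotient of `k` by the coordinate of `e` has nonnegative order at `x`, so it is a regular
function `g` near `x`, and `g • e` is the section sought. At the generic point no bound is needed.
-/
lemma exists_section_of_le_ord (hM : IsLineBundle M) {U : C.Opens} {x : C} (hx : x ∈ U)
    {V : C.Opens} (hxV : x ∈ V) {e : Γ(M, V)} (he : IsFrame M V e) (k : C.functionField)
    (hk : x ≠ genericPoint C → k ≠ 0 →
      Scheme.ord (F.coord V (genericPoint_mem hxV) e) x ≤ Scheme.ord k x) :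
    ∃ (W : C.Opens) (_ : W ≤ U) (hxW : x ∈ W) (t : Γ(M, W)),
      F.coord W (genericPoint_mem hxW) t = k := by
  have he0 := F.coord_frame_ne_zero hM he (genericPoint_mem hxV)
  obtain ⟨W, hW, hxW, g, hg⟩ : ∃ (W : C.Opens) (_ : W ≤ U ⊓ V) (hxW : x ∈ W) (g : Γ(C, W)),
      gval W (genericPoint_mem hxW) g = k * (F.coord V (genericPoint_mem hxV) e)⁻¹ := by
    by_cases hη : x = genericPoint C
    · subst hη
      exact exists_gval_eq (Opens.mem_inf.2 ⟨hx, hxV⟩) _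
    obtain ⟨r, hr⟩ : ∃ r : C.presheaf.stalk x,
        algebraMap _ _ r = k * (F.coord V (genericPoint_mem hxV) e)⁻¹ := by
      by_cases hk0 : k = 0
      · exact ⟨0, by rw [hk0, map_zero, zero_mul]⟩
      refine (ord_nonneg_iff hη (mul_ne_zero hk0 (inv_ne_zero he0))).1 ?_
      have h1 := hk hη hk0
      have h2 := (functionFieldValuations C).ord_inv ⟨x, hη⟩ he0
      change Scheme.ord _ x = - Scheme.ord _ x at h2
      rw [Scheme.ord_mul hk0 (inv_ne_zero he0), h2]
      omega
    rw [← hr]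
    exact exists_gval_eq_algebraMap (Opens.mem_inf.2 ⟨hx, hxV⟩) r
  refine ⟨W, hW.trans inf_le_left, hxW, g • mres M (hW.trans inf_le_right) e, ?_⟩
  rw [F.coord_smul, F.coord_mres, hg, inv_mul_cancel_right₀ he0]

/-- Near `x` one has `t = b • e` with `b` regular, so `b` has nonnegative order. -/
lemma ord_le_ord_coord {U : C.Opens} {x : C} (hx : x ∈ U) (t : Γ(M, U))
    (ht : F.coord U (genericPoint_mem hx) t ≠ 0) {V : C.Opens} (hxV : x ∈ V) {e : Γ(M, V)}
    (he : IsFrame M V e) (hη : x ≠ genericPoint C) :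
    Scheme.ord (F.coord V (genericPoint_mem hxV) e) x ≤
      Scheme.ord (F.coord U (genericPoint_mem hx) t) x := by
  obtain ⟨b, hb⟩ := (he (U ⊓ V) inf_le_right).2 (mres M inf_le_left t)
  change b • mres M inf_le_right e = mres M inf_le_left t at hb
  have hxUV : x ∈ U ⊓ V := Opens.mem_inf.2 ⟨hx, hxV⟩
  have h1 : F.coord U (genericPoint_mem hx) t =
      gval _ (genericPoint_mem hxUV) b * F.coord V (genericPoint_mem hxV) e := by
    rw [← F.coord_mres inf_le_left (genericPoint_mem hxUV) t, ← hb, F.coord_smul, F.coord_mres]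
  rw [h1] at ht ⊢
  obtain ⟨h2, h3⟩ := mul_ne_zero_iff.1 ht
  rw [Scheme.ord_mul h2 h3]
  have := (ord_nonneg_iff hη h2).2 ⟨C.presheaf.germ _ x hxUV b, algebraMap_germ hxUV _ b⟩
  omega

/-- The sections of a line bundle are the rational functions with poles bounded by the divisor of
a rational section `s`: divide by `s`. -/
def lineBundleModel (hM : IsLineBundle M) {V : C.Opens} (hV : genericPoint C ∈ V) (s : Γ(M, V))
    (hs : s ≠ 0) (D : {x : C.toTopCat // x ≠ genericPoint C} →₀ ℤ)
    (hD : ∀ p, HasOrderAt M s p.1 (D p)) :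
    SectionModel (functionFieldValuations C) (toC M) D where
  val U hU :=
    { toFun := fun t : Γ(M, U) => F.coord U hU t * (F.coord V hV s)⁻¹
      map_add' := fun t t' => by rw [← add_mul]; exact congr($(F.coord_add U hU t t') * _)
      map_smul' := fun c t => by
        rw [RingHom.id_apply, ← smul_mul_assoc]
        exact congr($(coord_smul_constant F U hU c t) * _) }
  injective U hU := by
    rw [injective_iff_map_eq_zero]
    intro t ht
    refine F.coord_injective hM U hU t ((mul_eq_zero_iff_right ?_).1 ht)
    exact inv_ne_zero fun h => hs (F.coord_injective hM V hV s h)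
  exists_iff U hU k := by
    have hs0 : F.coord V hV s ≠ 0 := fun h => hs (F.coord_injective hM V hV s h)
    constructor
    · rintro ⟨t, rfl⟩ p hp hk
      change F.coord U hU t * (F.coord V hV s)⁻¹ ≠ 0 at hk
      change - D p ≤ Scheme.ord (F.coord U hU t * (F.coord V hV s)⁻¹) p.1
      obtain ⟨ht, hi⟩ := mul_ne_zero_iff.1 hk
      obtain ⟨U', hx, e, he, hord⟩ := exists_frame_of_hasOrderAt F hM hV hs (hD p)
      have h1 := ord_le_ord_coord F hp t ht hx he p.2
      have h2 := (functionFieldValuations C).ord_inv p hs0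
      change Scheme.ord _ p.1 = - Scheme.ord _ p.1 at h2
      rw [Scheme.ord_mul ht hi, h2]
      omega
    · intro hk
      -- The coordinate of `s` has order `D x + ord e` at `x`, so `k` times it has order at least
      -- `ord e` and comes from a local section. The local sections agree on overlaps because
      -- coordinates determine sections.
      have hloc : ∀ x : U, ∃ (W : C.Opens) (_ : W ≤ U) (hxW : x.1 ∈ W) (t : Γ(M, W)),
          F.coord W (genericPoint_mem hxW) t = k * F.coord V hV s := by
        intro x
        by_cases hη : x.1 = genericPoint C
        · obtain ⟨U', e, hx, he⟩ := hM x.1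
          exact exists_section_of_le_ord F hM x.2 hx he _ fun hη' => absurd hη hη'
        obtain ⟨U', hx, e, he, hord⟩ := exists_frame_of_hasOrderAt F hM hV hs (hD ⟨x.1, hη⟩)
        refine exists_section_of_le_ord F hM x.2 hx he _ fun _ hne => ?_
        have hk0 : k ≠ 0 := left_ne_zero_of_mul hne
        have h1 := hk ⟨x.1, hη⟩ x.2 hk0
        change - D ⟨x.1, hη⟩ ≤ Scheme.ord k x.1 at h1
        rw [Scheme.ord_mul hk0 hs0]
        change Scheme.ord _ x.1 = _ + Scheme.ord _ x.1 at hord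
        omega
      choose W hWU hxW t ht using hloc
      obtain ⟨t', ht'⟩ := exists_glue M W hWU hxW t fun x y => by
        have hη := genericPoint_mem_inf (genericPoint_mem (hxW x)) (genericPoint_mem (hxW y))
        refine F.coord_inj hM _ hη ?_
        rw [F.coord_mres, F.coord_mres, ht, ht]
      refine ⟨t', ?_⟩
      change F.coord U hU t' * (F.coord V hV s)⁻¹ = k
      rw [← F.coord_mres (hWU ⟨_, hU⟩) (genericPoint_mem (hxW _)), ht', ht,
        mul_inv_cancel_right₀ hs0]
  val_res h hV' t := congr($(F.coord_mres h hV' t) * _)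

lemma lineBundleModel_smul (hM : IsLineBundle M) {V : C.Opens} (hV : genericPoint C ∈ V)
    (s : Γ(M, V)) (hs : s ≠ 0) (D : {x : C.toTopCat // x ≠ genericPoint C} →₀ ℤ)
    (hD : ∀ p, HasOrderAt M s p.1 (D p)) (U : C.Opens) (hU : genericPoint C ∈ U) (g : Γ(C, U))
    (t : Γ(M, U)) :
    (lineBundleModel F hM hV s hs D hD).val U hU (g • t) =
      gval U hU g * (lineBundleModel F hM hV s hs D hD).val U hU t := by
  change F.coord U hU (g • t) * _ = _ * (F.coord U hU t * _)
  rw [F.coord_smul, mul_assoc]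

end LineBundleModel

/-! ### The structure sheaf and its global sections -/

section StructureSheaf

variable {C : Scheme.{0}}

/-- The constant function `1` as a section of the structure sheaf. -/
def oneSection (U : C.Opens) : Γ(structureSheaf C, U) := (1 : Γ(C, U))

lemma smul_oneSection (U : C.Opens) (f : Γ(C, U)) :
    f • oneSection U = (f : Γ(structureSheaf C, U)) :=
  mul_one f

@[simp] lemma mres_oneSection {U V : C.Opens} (h : V ≤ U) :
    mres (structureSheaf C) h (oneSection U) = oneSection V :=
  map_one (fres h)

lemma isFrame_oneSection (U : C.Opens) : IsFrame (structureSheaf C) U (oneSection U) := by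
  intro V h
  simp only [mres_oneSection, smul_oneSection]
  exact Function.bijective_id

variable (C) in
lemma isLineBundle_structureSheaf : IsLineBundle (structureSheaf C) :=
  fun _ => ⟨⊤, oneSection ⊤, trivial, isFrame_oneSection ⊤⟩

/-- An open set missing the generic point is empty. -/
lemma subsingleton_structureSheaf [IsIntegral C] {V : C.Opens} (hV : genericPoint C ∉ V) :
    Subsingleton Γ(structureSheaf C, V) := by
  refine ⟨fun s t => ?_⟩
  rw [← sub_eq_zero]
  exact mres_eq_zero_of_locally _ _ fun x hx => absurd (genericPoint_mem hx) hV

lemma oneSection_ne_zero [IsIntegral C] {V : C.Opens} (hV : genericPoint C ∈ V) :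
    oneSection V ≠ 0 := by
  intro h
  have : gval V hV 1 = gval V hV 0 := congrArg (gval V hV) h
  rw [map_one, map_zero] at this
  exact one_ne_zero this

lemma hasOrderAt_oneSection [IsIntegral C] [IsLocallyNoetherian C] (x : C) :
    HasOrderAt (structureSheaf C) (oneSection ⊤) x 0 :=
  have : Nonempty (⊤ : C.Opens) := ⟨⟨x, trivial⟩⟩
  ⟨⊤, oneSection ⊤, ⊤, le_rfl, le_rfl, this, 1, trivial, isFrame_oneSection ⊤,
    by rw [one_smul], Scheme.ord_of_isUnit isUnit_one (Opens.mem_top x)⟩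

variable [C.Over SpecC] [IsSmoothProjectiveCurve C]

variable (C) in
/-- The structure sheaf as a sheaf of rational functions. -/
def structureModel : SectionModel (functionFieldValuations C) (toC (structureSheaf C)) 0 :=
  lineBundleModel ⟨⊤, trivial, oneSection ⊤, isFrame_oneSection ⊤⟩ (isLineBundle_structureSheaf C)
    (Opens.mem_top (genericPoint C)) (oneSection ⊤) (oneSection_ne_zero trivial) 0
    fun p => hasOrderAt_oneSection p.1

/-- Properness and integrality make the global functions a finite field extension of `ℂ`, hence `ℂ`
itself. -/
lemma finrank_globalSections_structureSheaf :
    Module.finrank ℂ Γ(structureSheaf C, ⊤) = 1 := by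
  have := IsSmoothProjectiveCurve.isProper (C := C)
  have hf := isField_of_universallyClosed ℂ (C ↘ SpecC)
  have hfin := finite_appTop_of_universallyClosed ℂ (C ↘ SpecC)
  have hfin' : (constants (⊤ : C.Opens)).Finite := by
    have h1 := hfin.comp (RingHom.Finite.of_surjective _
      (Scheme.ΓSpecIso (.of ℂ)).symm.commRingCatIsoToRingEquiv.surjective)
    convert! h1 using 1
    ext c
    change fres le_top _ = _
    simp [fres]
  have : Module.Finite ℂ Γ(C, ⊤) := hfin'
  let := hf.toField
  have hbij := IsAlgClosed.algebraMap_bijective_of_isIntegral (k := ℂ) (K := Γ(C, ⊤))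
  have h1 : Module.finrank ℂ Γ(C, ⊤) = 1 := by
    rw [← Module.finrank_self ℂ]
    exact (LinearEquiv.ofBijective (Algebra.linearMap ℂ Γ(C, ⊤)) hbij).finrank_eq.symm
  exact h1

end StructureSheaf

/-! ### Sheaves of morphisms as sheaves of rational functions -/

section SheafHomModel

variable {C : Scheme.{0}} [C.Over SpecC] [IsSmoothProjectiveCurve C] {M N : C.Modules}
  {D E : {x : C.toTopCat // x ≠ genericPoint C} →₀ ℤ}
  (P : SectionModel (functionFieldValuations C) (toC M) D)
  (Q : SectionModel (functionFieldValuations C) (toC N) E)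

/-- Near each point there is a section with a given value. -/
lemma SectionModel.exists_val_eq {U : C.Opens} (hU : genericPoint C ∈ U) (k : C.functionField) :
    ∃ (V : C.Opens) (_ : V ≤ U) (hV : genericPoint C ∈ V) (t : Γ(M, V)), P.val V hV t = k ∧
      ∀ p : {x : C.toTopCat // x ≠ genericPoint C}, p.1 ∈ U →
        k ∈ (functionFieldValuations C).poles p (D p) → p.1 ∈ V := by
  let B := SectionModel.badPoints D ((functionFieldValuations C).diag k)
  have hη := isCurveGenericPoint_genericPoint (C := C)
  let V : C.Opens := U ⊓ SectionModel.complOpen hη (SectionModel.finite_badPoints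
    (D := D) ((functionFieldValuations C).diag k)) (SectionModel.generic_notMem_badPoints _)
  have hV : genericPoint C ∈ V := Opens.mem_inf.2 ⟨hU, (SectionModel.mem_complOpen hη _ _).2
    (SectionModel.generic_notMem_badPoints _)⟩
  refine ⟨V, inf_le_left, hV, P.lift hV k fun p hp => ?_, P.val_lift _ _ _, fun p hp hk => ?_⟩
  · exact SectionModel.coe_notMem_badPoints.1
      ((SectionModel.mem_complOpen hη _ _).1 (Opens.mem_inf.1 hp).2)
  · exact Opens.mem_inf.2 ⟨hp, (SectionModel.mem_complOpen hη _ _).2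
      (SectionModel.coe_notMem_badPoints.2 hk)⟩

/-- Values are compatible with multiplication by functions. -/
def SectionModel.IsLinear {M : C.Modules} {D : {x : C.toTopCat // x ≠ genericPoint C} →₀ ℤ}
    (P : SectionModel (functionFieldValuations C) (toC M) D) : Prop :=
  ∀ (U : C.Opens) (hU : genericPoint C ∈ U) (g : Γ(C, U)) (t : Γ(M, U)),
    P.val U hU (g • t) = gval U hU g * P.val U hU t

variable {P Q} in
/-- A morphism `M → N` over `U` is multiplication by a rational function. -/
lemma existsUnique_multiplier (hP : P.IsLinear) (hQ : Q.IsLinear) {U : C.Opens}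
    (hU : genericPoint C ∈ U) (φ : LocalHom M N U) :
    ∃! k : C.functionField, ∀ (V : C.Opens) (h : V ≤ U) (hV : genericPoint C ∈ V) (t : Γ(M, V)),
      Q.val V hV (φ.1 ⟨V, h⟩ t) = k * P.val V hV t := by
  -- The multiplier is the value of `φ` on a section `t₀` of value `1`. After shrinking, every
  -- section is a function times `t₀`.
  obtain ⟨V₀, h₀, hV₀, t₀, ht₀, -⟩ := P.exists_val_eq hU 1
  refine ⟨Q.val V₀ hV₀ (φ.1 ⟨V₀, h₀⟩ t₀), fun V h hV t => ?_, fun k hk => ?_⟩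
  · obtain ⟨W, hW, hηW, g, hg⟩ := exists_gval_eq (genericPoint_mem_inf hV hV₀) (P.val V hV t)
    have hWV : W ≤ V := hW.trans inf_le_left
    have hWV₀ : W ≤ V₀ := hW.trans inf_le_right
    have hres : ∀ {V' : C.Opens} (h' : W ≤ V') (s : Γ(M, V')),
        P.val W hηW (mres M h' s) = P.val V' (h' hηW) s := fun h' s => P.val_res h' hηW s
    have hres' : ∀ {V' : C.Opens} (h' : W ≤ V') (s : Γ(N, V')),
        Q.val W hηW (mres N h' s) = Q.val V' (h' hηW) s := fun h' s => Q.val_res h' hηW s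
    have h1 : mres M hWV t = g • mres M hWV₀ t₀ := by
      refine P.injective W hηW ?_
      rw [hP, hres, hres, ht₀, hg, mul_one]
    have h2 := φ.2 ⟨V, h⟩ ⟨W, hWV.trans h⟩ hWV t
    have h3 := φ.2 ⟨V₀, h₀⟩ ⟨W, hWV.trans h⟩ hWV₀ t₀
    rw [← hres' hWV, ← h2, h1, map_smul, hQ, h3, hres', hg, mul_comm]
  · rw [hk V₀ h₀ hV₀ t₀, ht₀, mul_one]

/-- The rational function by which a morphism multiplies. -/
def multiplier (hP : P.IsLinear) (hQ : Q.IsLinear) {U : C.Opens} (hU : genericPoint C ∈ U)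
    (φ : LocalHom M N U) : C.functionField :=
  (existsUnique_multiplier hP hQ hU φ).choose

variable {P Q} (hP : P.IsLinear) (hQ : Q.IsLinear)

lemma val_eq_multiplier_mul {U V : C.Opens} (h : V ≤ U) (hV : genericPoint C ∈ V)
    (φ : LocalHom M N U) (t : Γ(M, V)) :
    Q.val V hV (φ.1 ⟨V, h⟩ t) = multiplier P Q hP hQ (h hV) φ * P.val V hV t :=
  (existsUnique_multiplier hP hQ (h hV) φ).choose_spec.1 V h hV t

lemma multiplier_eq {U : C.Opens} (hU : genericPoint C ∈ U) (φ : LocalHom M N U)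
    (k : C.functionField)
    (hk : ∀ (V : C.Opens) (h : V ≤ U) (hV : genericPoint C ∈ V) (t : Γ(M, V)),
      Q.val V hV (φ.1 ⟨V, h⟩ t) = k * P.val V hV t) : multiplier P Q hP hQ hU φ = k :=
  ((existsUnique_multiplier hP hQ hU φ).choose_spec.2 k hk).symm

/-- Multiplication by `k` turns poles bounded by `D` into poles bounded by `E`. On opens without the
generic point the target is zero, so the map there is forced. -/
lemma exists_localHom_of_forall (hN : ∀ V : C.Opens, genericPoint C ∉ V → Subsingleton Γ(N, V))
    {U : C.Opens} (hU : genericPoint C ∈ U) (k : C.functionField)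
    (hk : ∀ p : {x : C.toTopCat // x ≠ genericPoint C}, p.1 ∈ U →
      k ∈ (functionFieldValuations C).poles p ((E - D) p)) :
    ∃ φ : LocalHom M N U, multiplier P Q hP hQ hU φ = k := by
  classical
  have hpoles : ∀ (V : C.Opens) (_ : V ≤ U) (hV : genericPoint C ∈ V) (t : Γ(M, V))
      (p : {x : C.toTopCat // x ≠ genericPoint C}), p.1 ∈ V →
      k * P.val V hV t ∈ (functionFieldValuations C).poles p (E p) := by
    intro V h hV t p hp
    have := (functionFieldValuations C).mul_mem_poles (hk p (h hp)) (P.val_mem hV t p hp)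
    rwa [Finsupp.sub_apply, sub_add_cancel] at this
  let f : ∀ V : {V : C.Opens // V ≤ U}, Γ(M, V.1) → Γ(N, V.1) := fun V t =>
    if hV : genericPoint C ∈ V.1 then Q.lift hV (k * P.val V.1 hV t) (hpoles V.1 V.2 hV t) else 0
  have hf : ∀ (V : {V : C.Opens // V ≤ U}) (hV : genericPoint C ∈ V.1) (t : Γ(M, V.1)),
      Q.val V.1 hV (f V t) = k * P.val V.1 hV t := by
    intro V hV t
    exact (congrArg (Q.val V.1 hV) (dif_pos hV)).trans (Q.val_lift _ _ _)
  let φ : ∀ V : {V : C.Opens // V ≤ U}, Γ(M, V.1) →ₗ[Γ(C, V.1)] Γ(N, V.1) := fun V =>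
    { toFun := f V
      map_add' := fun s t => by
        by_cases hV : genericPoint C ∈ V.1
        · refine Q.injective V.1 hV ?_
          have h1 := map_add (P.val V.1 hV) s t
          have h2 := map_add (Q.val V.1 hV) (f V s) (f V t)
          exact (((hf V hV _).trans (congrArg (k * ·) h1)).trans (mul_add _ _ _)).trans
            ((congrArg₂ (· + ·) (hf V hV s) (hf V hV t)).symm.trans h2.symm)
        · exact @Subsingleton.elim _ (hN V.1 hV) _ _
      map_smul' := fun g t => by
        by_cases hV : genericPoint C ∈ V.1
        · refine Q.injective V.1 hV ?_
          rw [RingHom.id_apply, hQ, hf, hf, hP]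
          ring
        · exact @Subsingleton.elim _ (hN V.1 hV) _ _ }
  refine ⟨⟨φ, fun V W h s => ?_⟩, multiplier_eq hP hQ hU _ k fun V h hV t => hf ⟨V, h⟩ hV t⟩
  by_cases hW : genericPoint C ∈ W.1
  · refine Q.injective W.1 hW ?_
    have h1 := P.val_res h hW s
    have h2 := Q.val_res h hW (φ V s)
    exact ((hf W hW _).trans (by
      change k * P.val W.1 hW (res (toC M) h s) = _; rw [h1, ← hf V (h hW)]; rfl)).trans h2.symm
  · exact @Subsingleton.elim _ (hN W.1 hW) _ _

/-- The sheaf of morphisms between two sheaves of rational functions, as a sheaf of rational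
functions. -/
def sheafHomModel (hN : ∀ V : C.Opens, genericPoint C ∉ V → Subsingleton Γ(N, V)) :
    SectionModel (functionFieldValuations C) (sheafHom M N) (E - D) where
  val U hU :=
    { toFun := multiplier P Q hP hQ hU
      map_add' := fun φ ψ => multiplier_eq hP hQ hU _ _ fun V h hV t => by
        rw [add_mul, ← val_eq_multiplier_mul hP hQ h hV φ, ← val_eq_multiplier_mul hP hQ h hV ψ]
        exact map_add (Q.val V hV) _ _
      map_smul' := fun c φ => multiplier_eq hP hQ hU _ _ fun V h hV t => by
        rw [RingHom.id_apply, smul_mul_assoc, ← val_eq_multiplier_mul hP hQ h hV φ]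
        exact map_smul (Q.val V hV) c _ }
  injective U hU := by
    rw [injective_iff_map_eq_zero]
    intro φ hφ
    change multiplier P Q hP hQ hU φ = 0 at hφ
    refine Subtype.ext (funext fun V => LinearMap.ext fun t => ?_)
    by_cases hV : genericPoint C ∈ V.1
    · refine Q.injective V.1 hV ?_
      have h1 := val_eq_multiplier_mul hP hQ V.2 hV φ t
      rw [hφ, zero_mul] at h1
      exact h1.trans (map_zero _).symm
    · exact @Subsingleton.elim _ (hN V.1 hV) _ _
  exists_iff U hU k := by
    refine ⟨?_, fun hk => exists_localHom_of_forall hP hQ hN hU k hk⟩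
    rintro ⟨φ, rfl⟩ p hp hk
    change multiplier P Q hP hQ hU φ ≠ 0 at hk
    change _ ≤ (functionFieldValuations C).ord p (multiplier P Q hP hQ hU φ)
    -- To bound the multiplier at `p`, test it on a section with the largest allowed pole there: `k
    -- * u` has pole order at most `E p`, while `u` has exactly `D p`.
    obtain ⟨u, hu0, hu⟩ := (functionFieldValuations C).exists_ord_eq p (-D p)
    obtain ⟨V, hVU, hV, t, ht, hpV⟩ := P.exists_val_eq hU u
    have h1 := val_eq_multiplier_mul hP hQ hVU hV φ t
    have h2 := Q.val_mem hV (φ.1 ⟨V, hVU⟩ t) p (hpV p hp fun _ => hu.ge)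
    rw [h1, ht] at h2
    have h3 := h2 (mul_ne_zero hk hu0)
    rw [(functionFieldValuations C).ord_mul p _ _ hk hu0, hu] at h3
    rw [Finsupp.sub_apply]
    omega
  val_res h hV φ := multiplier_eq hP hQ hV _ _ fun W hW hηW t =>
    val_eq_multiplier_mul hP hQ (hW.trans h) hηW φ t

/-- Evaluation at a section is multiplication by its value. -/
lemma sheafHomModel_evalAt (hN : ∀ V : C.Opens, genericPoint C ∉ V → Subsingleton Γ(N, V))
    (s : Γ(M, ⊤)) (U : C.Opens) (hU : genericPoint C ∈ U) (φ : (sheafHom M N).obj (.op U)) :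
    Q.val U hU (((evalAt M N s).app (.op U)).hom φ) =
      (P.globalSections s : C.functionField) * (sheafHomModel hP hQ hN).val U hU φ := by
  have h1 := val_eq_multiplier_mul hP hQ le_rfl hU φ (mres M le_top s)
  have h2 : P.val U hU (mres M le_top s) = P.val ⊤ (Opens.mem_top _) s := P.val_res le_top hU s
  rw [h2] at h1
  rw [mul_comm]
  exact h1

end SheafHomModel

/-! ### The long exact sequence and the cup product -/

section Exactness

/-- By exactness `δ` is injective iff `p = 0`, that is, iff the one-dimensional range of `i` is all
of `B`. -/
lemma finrank_eq_one_iff_injective {A B D H : Type*} [AddCommGroup A] [Module ℂ A]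
    [AddCommGroup B] [Module ℂ B] [AddCommGroup D] [Module ℂ D] [AddCommGroup H] [Module ℂ H]
    {i : A →ₗ[ℂ] B} {p : B →ₗ[ℂ] D} {δ : D →ₗ[ℂ] H} (hA : Module.finrank ℂ A = 1)
    (hi : Function.Injective i) (hip : Function.Exact i p) (hp : Function.Exact p δ) :
    Module.finrank ℂ B = 1 ↔ Function.Injective δ := by
  have hr : Module.finrank ℂ (LinearMap.range i) = 1 :=
    (LinearMap.finrank_range_of_inj hi).trans hA
  rw [← LinearMap.ker_eq_bot, LinearMap.exact_iff.1 hp, LinearMap.range_eq_bot,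
    ← LinearMap.ker_eq_top, LinearMap.exact_iff.1 hip]
  constructor
  · intro hB
    -- `finrank` is zero on infinite-dimensional spaces, so the value one includes finiteness.
    have : FiniteDimensional ℂ B := Module.finite_of_finrank_pos (by omega)
    exact Submodule.eq_top_of_finrank_eq (hr.trans hB.symm)
  · intro h
    rwa [h, finrank_top] at hr

variable {C : Scheme.{0}} {M N : C.Modules}

lemma app_mres (φ : M ⟶ N) {U V : C.Opens} (h : V ≤ U) (s : Γ(M, U)) :
    φ.app V (mres M h s) = mres N h (φ.app U s) :=
  congr($(φ.mapPresheaf.naturality (homOfLE h).op) s)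

/-- Taking sections over an open subset. -/
def sectionsFunctor (U : C.Opens) : C.Modules ⥤ Ab :=
  Scheme.Modules.toPresheaf C ⋙ (evaluation _ _).obj (.op U)

instance (U : C.Opens) : Limits.PreservesLimits (sectionsFunctor U) :=
  have : Limits.PreservesLimits ((evaluation (Opens C)ᵒᵖ Ab.{0}).obj (.op U)) :=
    ⟨fun {_} => Limits.evaluation_preservesLimitsOfShape _⟩
  Limits.comp_preservesLimits (Scheme.Modules.toPresheaf C) ((evaluation _ _).obj _)

instance (U : C.Opens) : (sectionsFunctor U).PreservesZeroMorphisms where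
  map_zero _ _ := rfl

lemma Extension.app_i_injective (X : Extension M) (U : C.Opens) :
    Function.Injective (X.i.app U) := by
  have := X.shortExact.mono_f
  have : Mono ((sectionsFunctor U).map X.i) := inferInstance
  exact (AddCommGrpCat.mono_iff_injective _).1 this

lemma Extension.exact_app (X : Extension M) (U : C.Opens) :
    Function.Exact (X.i.app U) (X.p.app U) := by
  have := X.shortExact.mono_f
  have := X.shortExact.exact.map_of_mono_of_preservesKernel (sectionsFunctor U) inferInstance
    inferInstance
  exact (ShortComplex.ab_exact_iff_function_exact _).1 this

variable [C.Over SpecC]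

/-- The `ℂ`-linear map on sections given by a morphism. -/
def appL (φ : M ⟶ N) (U : C.Opens) : Γ(M, U) →ₗ[ℂ] Γ(N, U) where
  toFun := φ.app U
  map_add' := map_add _
  map_smul' a s := φ.app_smul (constants U a) s

/-- The cup product is the connecting homomorphism. The sections `σ x s` are local lifts of `s` to
`E`, and they differ on overlaps by the cocycle `c x y` evaluated at `s`. This cocycle bounds after
refinement exactly when the lifts can be corrected by sections of `𝒪` so as to glue. -/
lemma Extension.exact_cup {X : Extension M} {b : H1 (dual M)} (hb : X.HasClass b) :
    Function.Exact (appL X.p ⊤) (cup M b) := by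
  obtain ⟨𝒰, σ, c, hσ, hc, rfl⟩ := hb
  intro s
  have hcup : cup M (H1.mk (dual M) 𝒰 c) s =
      H1.mk (toC (structureSheaf C)) 𝒰 (cocyclesMap (evalAt M (structureSheaf C) s) 𝒰 c) :=
    H1.map_mk _ _ _
  rw [hcup, H1.mk_eq_zero_iff]
  constructor
  · rintro ⟨𝒱, h, hu'⟩
    obtain ⟨u, hu⟩ : ∃ u : ∀ x : C, Γ(structureSheaf C, 𝒱.nhd x),
      coboundary (toC (structureSheaf C)) 𝒱 u = _ := hu'
    let t : ∀ x : C, Γ(X.E, 𝒱.nhd x) := fun x =>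
      (σ x).1 ⟨𝒱.nhd x, h x⟩ (mres M le_top s) - X.i.app _ (u x)
    have hcoc : ∀ x y : C, mres X.E inf_le_left (t x) =
        mres X.E (inf_le_right : 𝒱.nhd x ⊓ 𝒱.nhd y ≤ 𝒱.nhd y) (t y) := by
      intro x y
      have h1 : mres (structureSheaf C) inf_le_right (u y) -
          mres (structureSheaf C) inf_le_left (u x) =
          mres (structureSheaf C) (inf_le_inf (h x) (h y))
            ((show LocalHom M (structureSheaf C) (𝒰.nhd x ⊓ 𝒰.nhd y) from c.1 x y).1
              ⟨_, le_rfl⟩ (mres M le_top s)) := congr($(hu).1 x y)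
      have h2 := (show LocalHom M (structureSheaf C) (𝒰.nhd x ⊓ 𝒰.nhd y) from c.1 x y).2
        ⟨_, le_rfl⟩ ⟨𝒱.nhd x ⊓ 𝒱.nhd y, inf_le_inf (h x) (h y)⟩ (inf_le_inf (h x) (h y))
        (mres M le_top s)
      have h3 := hc x y (𝒱.nhd x ⊓ 𝒱.nhd y) (inf_le_left.trans (h x)) (inf_le_right.trans (h y))
        (mres M le_top s)
      have h4 := (σ x).2 ⟨𝒱.nhd x, h x⟩ ⟨𝒱.nhd x ⊓ 𝒱.nhd y, inf_le_left.trans (h x)⟩ inf_le_left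
        (mres M le_top s)
      have h5 := (σ y).2 ⟨𝒱.nhd y, h y⟩ ⟨𝒱.nhd x ⊓ 𝒱.nhd y, inf_le_right.trans (h y)⟩ inf_le_right
        (mres M le_top s)
      rw [mres_mres] at h2 h4 h5
      rw [← h2] at h1
      have h6 := congrArg (X.i.app _) h1
      rw [map_sub, app_mres, app_mres] at h6
      have h7 := h6.trans h3
      rw [h4, h5] at h7
      simp only [t, map_sub]
      rw [sub_eq_sub_iff_sub_eq_sub] at h7 ⊢
      rw [← sub_eq_zero] at h7 ⊢
      rw [← h7]
      abel
    obtain ⟨t', ht'⟩ := exists_glue X.E (U := ⊤) (fun x => 𝒱.nhd x.1) (fun _ => le_top)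
      (fun x => 𝒱.mem x.1) (fun x => t x.1) fun x y => hcoc x.1 y.1
    refine ⟨t', ?_⟩
    change X.p.app ⊤ t' = s
    rw [← sub_eq_zero]
    refine mres_eq_zero_of_locally M _ fun x hx => ⟨𝒱.nhd x, le_top, 𝒱.mem x, ?_⟩
    rw [map_sub, ← app_mres, ht' ⟨x, hx⟩]
    simp only [t]
    rw [map_sub, hσ, (X.exact_app _).apply_apply_eq_zero, sub_zero, sub_self]
  · rintro ⟨t, rfl⟩
    -- Given a global lift `t`, the differences `σ x s - t` lie in `𝒪` and form a cochain with
    -- coboundary `c` evaluated at `s`.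
    have hu : ∀ x : C, ∃ u : Γ(structureSheaf C, 𝒰.nhd x), X.i.app _ u =
        (σ x).1 ⟨𝒰.nhd x, le_rfl⟩ (mres M le_top (X.p.app ⊤ t)) - mres X.E le_top t := by
      intro x
      refine (X.exact_app _ _).1 ?_
      rw [map_sub, hσ, app_mres, sub_self]
    choose u hu using hu
    have hcoc : ∀ x y : C, X.i.app (𝒰.nhd x ⊓ 𝒰.nhd y)
        (mres _ inf_le_right (u y) - mres _ inf_le_left (u x)) = X.i.app (𝒰.nhd x ⊓ 𝒰.nhd y)
        ((show LocalHom M (structureSheaf C) (𝒰.nhd x ⊓ 𝒰.nhd y) from c.1 x y).1 ⟨_, le_rfl⟩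
          (mres M le_top (X.p.app ⊤ t))) := by
      intro x y
      have h4 := (σ x).2 ⟨𝒰.nhd x, le_rfl⟩ ⟨𝒰.nhd x ⊓ 𝒰.nhd y, inf_le_left⟩ inf_le_left
        (mres M le_top (X.p.app ⊤ t))
      have h5 := (σ y).2 ⟨𝒰.nhd y, le_rfl⟩ ⟨𝒰.nhd x ⊓ 𝒰.nhd y, inf_le_right⟩ inf_le_right
        (mres M le_top (X.p.app ⊤ t))
      rw [mres_mres] at h4 h5
      rw [hc x y _ inf_le_left inf_le_right, map_sub, app_mres, app_mres, hu, hu, map_sub,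
        map_sub, h4, h5, mres_mres, mres_mres]
      abel
    refine ⟨𝒰, le_rfl, u, ?_⟩
    ext x y
    exact (X.app_i_injective _ (hcoc x y)).trans (mres_self (structureSheaf C) _ _).symm

lemma Extension.finrank_eq_one_iff {X : Extension M} {b : H1 (dual M)} (hb : X.HasClass b)
    (hC : Module.finrank ℂ Γ(structureSheaf C, ⊤) = 1) :
    Module.finrank ℂ Γ(X.E, ⊤) = 1 ↔ Function.Injective (cup M b) :=
  finrank_eq_one_iff_injective (i := appL X.i ⊤) (p := appL X.p ⊤) hC (X.app_i_injective ⊤) (X.exact_app ⊤)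
    (X.exact_cup hb)

end Exactness

section Cup

variable {C : Scheme.{0}} [C.Over SpecC]

/-- The cup product as a bilinear map. -/
def cupL (M : C.Modules) : H1 (dual M) →ₗ[ℂ] Γ(M, ⊤) →ₗ[ℂ] cohH1 (structureSheaf C) where
  toFun := cup M
  map_add' b b' := LinearMap.ext fun s => map_add (H1.map (evalAt M (structureSheaf C) s)) b b'
  map_smul' a b := LinearMap.ext fun s => map_smul (H1.map (evalAt M (structureSheaf C) s)) a b

end Cup

/-! ### Degree and divisors on closed points -/

section Degree

lemma genericPoint_mem_of_ne_zero {C : Scheme.{0}} [IsIntegral C] {M : C.Modules} {V : C.Opens}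
    {s : Γ(M, V)} (hs : s ≠ 0) :
    genericPoint C ∈ V := by
  by_contra hV
  exact hs (mres_eq_zero_of_locally M s fun x hx => absurd (genericPoint_mem hx) hV)

variable {C : Scheme.{0}} [IsIntegral C] [IsLocallyNoetherian C] {M : C.Modules}

/-- The generic point has coheight zero, where `Scheme.ord` takes its default value `0`. Hence
discarding this point from a divisor does not change the degree. -/
lemma HasOrderAt.eq_zero_of_genericPoint {V : C.Opens} {s : Γ(M, V)} {n : ℤ}
    (h : HasOrderAt M s (genericPoint C) n) : n = 0 := by
  obtain ⟨U, e, W, hU, hV, hW, f, -, -, -, rfl⟩ := h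
  refine Scheme.ord_eq_zero_of_coheight_neq_one ?_ _
  have : Order.coheight (genericPoint C) = 0 := by
    rw [Order.coheight_eq_zero]
    intro x hx
    exact genericPoint_specializes x
  rw [this]
  exact zero_ne_one

/-- The degree is that of a divisor supported on the closed points. -/
lemma HasDegree.exists_divisor {d : ℤ} (h : HasDegree M d) :
    ∃ (V : C.Opens) (_ : genericPoint C ∈ V) (s : Γ(M, V)) (_ : s ≠ 0)
      (D : {x : C.toTopCat // x ≠ genericPoint C} →₀ ℤ),
      (∀ p, HasOrderAt M s p.1 (D p)) ∧ D.sum (fun _ n => n) = d := by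
  obtain ⟨V, s, D, hs, hD, rfl⟩ := h
  refine ⟨V, genericPoint_mem_of_ne_zero hs, s, hs, D.subtypeDomain _, fun p => hD p.1,
    Finsupp.sum_subtypeDomain_index (h := fun _ n => n) fun x hx hη => ?_⟩
  exact Finsupp.mem_support_iff.1 hx (by
    have := hD x
    generalize D x = n at this
    subst hη
    exact this.eq_zero_of_genericPoint)

end Degree

variable {C : Scheme.{0}} [C.Over SpecC] [IsSmoothProjectiveCurve C]

variable (C) in
lemma genus_eq_finrank_adelicH1 :
    genus C = Module.finrank ℂ ((functionFieldValuations C).AdelicH1 0) :=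
  ((structureModel C).equivAdelic isCurveGenericPoint_genericPoint).finrank_eq

variable (C) in
lemma finrank_L_zero : Module.finrank ℂ ((functionFieldValuations C).L 0) = 1 :=
  (structureModel C).globalSections.finrank_eq.symm.trans finrank_globalSections_structureSheaf

lemma structureModel_isLinear : (structureModel C).IsLinear := fun U hU g t =>
  lineBundleModel_smul _ _ _ _ _ _ _ U hU g t

end CurveExt

end

/-! ### The theorem -/

theorem proposition4p3 (C : Scheme.{0}) [C.Over CurveExt.SpecC]
    [CurveExt.IsSmoothProjectiveCurve C] (hg : 1 ≤ CurveExt.genus C)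
    (L : C.Modules) (hL : CurveExt.IsLineBundle L)
    (hd : CurveExt.HasDegree L (2 * (CurveExt.genus C : ℤ) - 1)) :
    (∀ (b : CurveExt.H1 (CurveExt.dual L)) (X : CurveExt.Extension L), X.HasClass b →
      (Module.finrank ℂ Γ(X.E, ⊤) = 1 ↔ Function.Bijective (CurveExt.cup L b))) ∧
    Module.Finite ℂ (CurveExt.H1 (CurveExt.dual L)) ∧
    ∃ U : Set (CurveExt.H1 (CurveExt.dual L)), CurveExt.IsZariskiOpen U ∧ U.Nonempty ∧
      ∀ b ∈ U, ∀ X : CurveExt.Extension L, X.HasClass b →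
        Module.finrank ℂ Γ(X.E, ⊤) = 1 := by
  open CurveExt in
  obtain ⟨V, hV, s, hs, D, hD, hdeg⟩ := hd.exists_divisor
  obtain ⟨F⟩ := hL.genericFrame
  have hη := isCurveGenericPoint_genericPoint (C := C)
  -- Positive genus is what gives finiteness of `H¹(𝒪)`, since `finrank` would otherwise be zero.
  have hfin : Module.Finite ℂ (cohH1 (structureSheaf C)) := Module.finite_of_finrank_pos hg
  have : Module.Finite ℂ ((functionFieldValuations C).AdelicH1 0) :=
    Module.Finite.equiv ((structureModel C).equivAdelic hη)
  have h0 := finrank_L_zero C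
  have : Module.Finite ℂ ((functionFieldValuations C).L 0) :=
    Module.finite_of_finrank_pos (by omega)
  let P := lineBundleModel F hL hV s hs D hD
  have hP : P.IsLinear := fun U hU g t => lineBundleModel_smul F hL hV s hs D hD U hU g t
  have hN : ∀ V : C.Opens, genericPoint C ∉ V → Subsingleton Γ(structureSheaf C, V) :=
    fun V hV => subsingleton_structureSheaf hV
  let R := sheafHomModel hP structureModel_isLinear hN
  rw [genus_eq_finrank_adelicH1] at hdeg
  obtain ⟨_, -, -⟩ := (functionFieldValuations C).riemannRoch D
  -- The dual of `L` has divisor `0 - D`, so this yields finiteness of its `H¹`.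
  obtain ⟨-, _, -⟩ := (functionFieldValuations C).riemannRoch (0 - D)
  have hΓfin : Module.Finite ℂ Γ(L, ⊤) := Module.Finite.equiv P.globalSections.symm
  have hΓ : Module.finrank ℂ Γ(L, ⊤) = Module.finrank ℂ (cohH1 (structureSheaf C)) :=
    P.globalSections.finrank_eq.trans (((functionFieldValuations C).finrank_L_eq h0 D hdeg).trans
      (genus_eq_finrank_adelicH1 C).symm)
  have hiff : ∀ (b : H1 (dual L)) (X : Extension L), X.HasClass b →
      (Module.finrank ℂ Γ(X.E, ⊤) = 1 ↔ Function.Bijective (cup L b)) := fun b X hb => by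
    rw [X.finrank_eq_one_iff hb finrank_globalSections_structureSheaf, Function.Bijective,
      ← LinearMap.injective_iff_surjective_of_finrank_eq_finrank hΓ, and_self]
  -- In the adelic model the cup product with `t` is multiplication `H¹(-D) → H¹(0)` by the rational
  -- function of `t`, which is surjective.
  have hsurj : ∀ t : Γ(L, ⊤), t ≠ 0 → Function.Surjective fun b => cupL L b t := by
    intro t ht q
    have hE : ⇑(0 - D) + ⇑D = ⇑(0 : {x : C.toTopCat // x ≠ genericPoint C} →₀ ℤ) := by
      ext p
      simp
    obtain ⟨a, ha⟩ := (functionFieldValuations C).mulH1_surjective hE (f := P.globalSections t)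
      ((LinearEquiv.map_ne_zero_iff _).2 ht) ((structureModel C).equivAdelic hη q)
    obtain ⟨b, rfl⟩ := (R.equivAdelic hη).surjective a
    refine ⟨b, ((structureModel C).equivAdelic hη).injective ?_⟩
    rw [← ha]
    exact R.equivAdelic_map hη (structureModel C) hE (evalAt L (structureSheaf C) t) _
      (sheafHomModel_evalAt hP structureModel_isLinear hN t) b
  exact ⟨hiff, Module.Finite.equiv (R.equivAdelic hη).symm, _,
    isZariskiOpen_setOf_bijective hΓ (cupL L),
    exists_bijective_of_forall_surjective hΓ (cupL L) hsurj, fun b hb X hX => (hiff b X hX).2 hb⟩
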